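/- All homeomorphisms are orientation-preserving homeomorphisms of $\mathbb{R}$; the support of $g$ is $\operatorname{supp} g=\{x : g(x)\ne x\}$, and $\operatorname{supp} G=\bigcup_{g\in G}\operatorname{supp} g$ for a group $G\le \mathrm{Homeo}^+(\mathbb{R})$. Let $n\ge 2$ and let $J_1,\dots,J_n$ be nonempty open (possibly unbounded) intervals of $\mathbb{R}$, with left endpoints $\partial^-J_i<\partial^-J_{i+1}$ for $i<n$, such that $J_i\cap J_k=\varnothing$ whenever $|i-k|>1$, and such that $J_i\cap J_{i+1}$ is a nonempty proper subinterval of both $J_i$ and $J_{i+1}$ for $i<n$. Let $f_1,\dots,f_n\in \mathrm{Homeo}^+(\mathbb{R})$ satisfy $\operatorname{supp} f_i=J_i$ and $f_i(t)\ge t$ for all $t$, and suppose that $\langle f_i,f_{i+1}\rangle$ is isomorphic to Thompson's group $F$ for each $i<n$. Then $G=\langle f_1,\dots,f_n\rangle$ is called an $n$-chain group with generators $f_1,\dots,f_n$. A group $G\le \mathrm{Homeo}^+(\mathbb{R})$ is called minimal if the orbit of every point of $\operatorname{supp} G$ is dense in $\operatorname{supp} G$. A minimal invariant set of $G$ is a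 minimal element (for inclusion) among the nonempty $G$-invariant subsets of $\operatorname{supp} G$ that are closed in $\operatorname{supp} G$; it is called exceptional if it is totally disconnected and has no isolated points. **Theorem.** Let $G$ be an $n$-chain group with generators $f_1,\dots,f_n$, where $n\ge2$. Then exactly one of the following holds. (i) $G$ is minimal. In this case every proper quotient of $G$ is abelian, and the commutator subgroup $G'$ is simple. (ii) The closure in $\mathbb{R}$ of some $G$-orbit is perfect and totally disconnected; equivalently, $G$ has a unique exceptional minimal invariant set $\Lambda$. In this case $G$ canonically surjects onto a minimal $n$-chain group, as follows. There are a continuous monotone non-decreasing surjection $h:\operatorname{supp} G\to\mathbb{R}$ that identifies two distinct points of $\operatorname{supp} G$ exactly when they lie in the closure of the same component of $\operatorname{supp} G\setminus\Lambda$ (a devil's staircase map) and a homomorphism $\Phi:G\to \mathrm{Homeo}^+(\mathbb{R})$ with $h\circ g=\Phi(g)\circ h$ on $\operatorname{supp} G$ for every $g\in G$, such that $\Phi(G)$ is a minimal $n$-chain group with generators $\Phi(f_1),\dots,\Phi(f_n)$ and with support $\mathbb{R}$. Any two pairs $(h_1,\Phi_1)$, $(h_2,\Phi_2)$ consisting of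 such a devil's staircase map and a homomorphism $G\to\mathrm{Homeo}^+(\mathbb{R})$ that it intertwines in this way are conjugate: there is $k\in \mathrm{Homeo}^+(\mathbb{R})$ with $h_2=k\circ h_1$ and $\Phi_2(g)=k\,\Phi_1(g)\,k^{-1}$ for all $g\in G$. -/

import Mathlib

open Set

/-- The group `Homeo⁺(ℝ)` of orientation preserving homeomorphisms of the real line. -/
def HomeoPlus : Subgroup (ℝ ≃ₜ ℝ) where
  carrier := {f | StrictMono f}
  one_mem' := strictMono_id
  mul_mem' := fun {_ _} hf hg _ _ hxy => hf (hg hxy)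
  inv_mem' := by
    intro f hf x y hxy
    have hf' : StrictMono f := hf
    have h : f (f⁻¹ x) < f (f⁻¹ y) := by
      rw [← Homeomorph.mul_apply, ← Homeomorph.mul_apply, mul_inv_cancel]
      exact hxy
    exact hf'.lt_iff_lt.1 h

/-- The support `{x | f x ≠ x}` of a homeomorphism. -/
def homeoSupport (f : ℝ ≃ₜ ℝ) : Set ℝ := {x | f x ≠ x}

/-- The support of a group of homeomorphisms: the union of the supports of its elements. -/
def groupSupport (G : Subgroup (ℝ ≃ₜ ℝ)) : Set ℝ := ⋃ g ∈ G, homeoSupport g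

/-- The orbit `G x`. -/
def groupOrbit (G : Subgroup (ℝ ≃ₜ ℝ)) (x : ℝ) : Set ℝ := {y | ∃ g ∈ G, g x = y}

/-- The translation `a x = x + 1`. -/
noncomputable def thompsonA : ℝ ≃ₜ ℝ := Homeomorph.addRight 1

/-- The map `b` with `b x = x` for `x ≤ 0`, `b x = 2 x` for `0 < x < 1` and `b x = x + 1` for
`1 ≤ x`. -/
noncomputable def thompsonB : ℝ ≃ₜ ℝ where
  toFun x := if x ≤ 0 then x else if x < 1 then 2 * x else x + 1
  invFun y := if y ≤ 0 then y else if y < 2 then y / 2 else y - 1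
  left_inv := by
    intro x
    dsimp only
    split_ifs <;> linarith
  right_inv := by
    intro x
    dsimp only
    split_ifs <;> linarith
  continuous_toFun := by
    have h : (fun x : ℝ => if x ≤ 0 then x else if x < 1 then 2 * x else x + 1)
        = fun x => max x (min (2 * x) (x + 1)) := by
      funext x
      split_ifs with h₁ h₂
      · rw [min_eq_left (by linarith), max_eq_left (by linarith)]
      · rw [min_eq_left (by linarith), max_eq_right (by linarith)]
      · rw [min_eq_right (by linarith), max_eq_right (by linarith)]
    rw [h]
    fun_prop
  continuous_invFun := by
    have h : (fun y : ℝ => if y ≤ 0 then y else if y < 2 then y / 2 else y - 1)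
        = fun y => min y (max (y / 2) (y - 1)) := by
      funext y
      split_ifs with h₁ h₂
      · rw [max_eq_left (by linarith), min_eq_left (by linarith)]
      · rw [max_eq_left (by linarith), min_eq_right (by linarith)]
      · rw [max_eq_right (by linarith), min_eq_right (by linarith)]
    rw [h]
    fun_prop

/-- Thompson's group `F`, in its standard copy `⟨a, b⟩` in `Homeo⁺(ℝ)`. -/
noncomputable def ThompsonF : Subgroup (ℝ ≃ₜ ℝ) := Subgroup.closure {thompsonA, thompsonB}

/-- The left endpoint `∂⁻J ∈ [-∞, ∞]` of an interval `J`. -/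
noncomputable def leftEnd (J : Set ℝ) : EReal := sInf ((fun x : ℝ => (x : EReal)) '' J)

/-- `J 0, …, J (n - 1)` is a chain of (nonempty, open, possibly unbounded) intervals of `ℝ`, listed
so that the left endpoints increase. -/
structure IsIntervalChain {n : ℕ} (J : Fin n → Set ℝ) : Prop where
  isOpen : ∀ i, IsOpen (J i)
  ordConnected : ∀ i, (J i).OrdConnected
  nonempty : ∀ i, (J i).Nonempty
  disjoint : ∀ i k : Fin n, (i : ℕ) + 1 < k → J i ∩ J k = ∅
  inter_nonempty : ∀ i k : Fin n, (i : ℕ) + 1 = k → (J i ∩ J k).Nonempty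
  inter_ssubset_left : ∀ i k : Fin n, (i : ℕ) + 1 = k → J i ∩ J k ⊂ J i
  inter_ssubset_right : ∀ i k : Fin n, (i : ℕ) + 1 = k → J i ∩ J k ⊂ J k
  leftEnd_lt : ∀ i k : Fin n, (i : ℕ) + 1 = k → leftEnd (J i) < leftEnd (J k)

/-- The homeomorphisms `f 0, …, f (n - 1)` generate a prechain group. -/
structure IsPrechain {n : ℕ} (f : Fin n → (ℝ ≃ₜ ℝ)) : Prop where
  mem_homeoPlus : ∀ i, f i ∈ HomeoPlus
  supports : IsIntervalChain fun i => homeoSupport (f i)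
  le_apply : ∀ i t, t ≤ f i t

/-- The homeomorphisms `f 0, …, f (n - 1)` are the distinguished generators of an `n`-chain group:
they generate a prechain group, and any two consecutive ones generate a copy of Thompson's
group `F`. -/
structure IsChainFamily {n : ℕ} (f : Fin n → (ℝ ≃ₜ ℝ)) : Prop extends IsPrechain f where
  thompson : ∀ i k : Fin n, (i : ℕ) + 1 = k →
    Nonempty (Subgroup.closure {f i, f k} ≃* ThompsonF)

/-- The group `⟨f 0, …, f (n - 1)⟩` generated by a family of homeomorphisms. -/
def chainGroup {n : ℕ} (f : Fin n → (ℝ ≃ₜ ℝ)) : Subgroup (ℝ ≃ₜ ℝ) :=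
  Subgroup.closure (range f)

/-- `f i` as an element of the group generated by the family `f`. -/
def chainGen {n : ℕ} (f : Fin n → (ℝ ≃ₜ ℝ)) (i : Fin n) : chainGroup f :=
  ⟨f i, Subgroup.subset_closure (mem_range_self i)⟩

/-- `G` acts minimally: every orbit (of a point of the support) is dense in the support. -/
def ActsMinimally (G : Subgroup (ℝ ≃ₜ ℝ)) : Prop :=
  ∀ x ∈ groupSupport G, groupSupport G ⊆ closure (groupOrbit G x)

/-- `Λ` is a nonempty `G`-invariant subset of `supp G` that is closed in `supp G`. -/
structure IsClosedInvariant (G : Subgroup (ℝ ≃ₜ ℝ)) (Λ : Set ℝ) : Prop where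
  nonempty : Λ.Nonempty
  subset_support : Λ ⊆ groupSupport G
  closed_in_support : closure Λ ∩ groupSupport G ⊆ Λ
  invariant : ∀ g ∈ G, ∀ x ∈ Λ, g x ∈ Λ

/-- `Λ` is a minimal invariant set for the action of `G` on `supp G`. -/
structure IsMinimalInvariant (G : Subgroup (ℝ ≃ₜ ℝ)) (Λ : Set ℝ) : Prop
    extends IsClosedInvariant G Λ where
  minimal : ∀ Λ' ⊆ Λ, IsClosedInvariant G Λ' → Λ' = Λ

/-- `Λ` is an exceptional minimal invariant set for the action of `G` on `supp G`: it is perfect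
(being closed in `supp G`, this means that it has no isolated point) and totally disconnected. -/
structure IsExceptionalMinimal (G : Subgroup (ℝ ≃ₜ ℝ)) (Λ : Set ℝ) : Prop
    extends IsMinimalInvariant G Λ where
  preperfect : Preperfect Λ
  totallyDisconnected : IsTotallyDisconnected Λ

/-- The map `h`, considered on `supp G`, is a devil's staircase map from `supp G` onto `ℝ`, which
semiconjugates the action of `G` to the action `Φ` on `ℝ`. Two points of `supp G` are identified by
`h` exactly when no point of `Λ` lies strictly between them, that is, when they are equal or lie in
the closure of the same component of `supp G \ Λ`. -/
structure IsStaircaseSemiconj (G : Subgroup (ℝ ≃ₜ ℝ)) (Λ : Set ℝ) (h : ℝ → ℝ)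
    (Φ : G →* (ℝ ≃ₜ ℝ)) : Prop where
  mem_homeoPlus : ∀ g : G, Φ g ∈ HomeoPlus
  continuousOn : ContinuousOn h (groupSupport G)
  monotoneOn : MonotoneOn h (groupSupport G)
  image_eq : h '' groupSupport G = univ
  semiconj : ∀ g : G, ∀ x ∈ groupSupport G, h ((g : ℝ ≃ₜ ℝ) x) = Φ g (h x)
  fibre : ∀ x ∈ groupSupport G, ∀ y ∈ groupSupport G, h x = h y ↔ uIoo x y ∩ Λ = ∅

open scoped commutatorElement

/-! ### Homeomorphisms of the line and their supports -/

/-! Write J_1, …, J_n for the supports of the generators. Everything rests on one point: the left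
end p of J_n, which lies in J_{n-1}. Any compact interval in supp G can be carried into J_n and then
pushed by a negative power of f_n into (p, p + ε). Hence p lies in the closure of every orbit in
supp G, and closure(Gp) ∩ supp G is contained in every nonempty closed invariant set, so it is the
unique minimal one. It has no isolated point, since p is a limit of other points of its own orbit.
If closure(Gp) has interior, then by invariance p is interior, and the part of supp G outside the
interior would be a closed invariant set missing p, hence is empty; so G is minimal. Otherwise
closure(Gp) is totally disconnected. This is the dichotomy (`IsContractingPoint.subset`,
`IsContractingPoint.isTotallyDisconnected`).

If G is minimal, compact sets can be compressed into any open interval of supp G, and Higman's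
argument (`commutator_mem_of_compresses`) puts into every nontrivial normal subgroup all commutators
of compactly supported elements. Germs at either end of supp G are powers of the germ of f_1 or f_n,
so elements of G' are compactly supported and every nontrivial normal subgroup contains G''. Finally
G'' = G': adjacent generators span a copy of F, F' is perfect, so adjacent generators already
commute in G/G''; the other pairs commute in G. The same argument inside G' gives simplicity,
because every element of G agrees on a given compact set with an element of G', so that G'
compresses too.

In the exceptional case the gaps of Λ are collapsed; Cantor's theorem on countable dense orders
identifies the quotient with ℝ. Since Λ meets every J_i, the supports of the Φ(f_i) are the images
of the J_i and again form a chain. Overlapping supports prevent Φ(f_i) and Φ(f_{i+1}) from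
commuting, while proper quotients of F are abelian, so Φ is injective on each ⟨f_i, f_{i+1}⟩.
Minimality of the image holds because every orbit accumulates on all of Λ, and uniqueness because Λ
determines the fibres of h. -/

theorem homeo_inv_apply_self (f : ℝ ≃ₜ ℝ) (x : ℝ) : f⁻¹ (f x) = x := f.symm_apply_apply x

theorem homeo_apply_inv_self (f : ℝ ≃ₜ ℝ) (x : ℝ) : f (f⁻¹ x) = x := f.apply_symm_apply x

theorem HomeoPlus.strictMono {f : ℝ ≃ₜ ℝ} (hf : f ∈ HomeoPlus) : StrictMono f := hf

theorem mem_groupSupport {G : Subgroup (ℝ ≃ₜ ℝ)} {x : ℝ} :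
    x ∈ groupSupport G ↔ ∃ g ∈ G, g x ≠ x := by
  simp [groupSupport, homeoSupport]

theorem apply_mem_groupSupport {G : Subgroup (ℝ ≃ₜ ℝ)} {g : ℝ ≃ₜ ℝ} (hg : g ∈ G) {x : ℝ}
    (hx : x ∈ groupSupport G) : g x ∈ groupSupport G := by
  by_contra h
  have hfix : ∀ k ∈ G, k (g x) = g x := by
    intro k hk
    by_contra hne
    exact h (mem_groupSupport.2 ⟨k, hk, hne⟩)
  obtain ⟨k, hk, hne⟩ := mem_groupSupport.1 hx
  have h1 := hfix g⁻¹ (G.inv_mem hg)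
  rw [homeo_inv_apply_self] at h1
  have h2 := hfix k hk
  rw [← h1] at h2
  exact hne h2

theorem groupSupport_closure (S : Set (ℝ ≃ₜ ℝ)) :
    groupSupport (Subgroup.closure S) = ⋃ g ∈ S, homeoSupport g := by
  apply Subset.antisymm
  · intro x hx
    by_contra hx'
    have hfix : ∀ g ∈ S, g x = x := by
      intro g hg
      by_contra hne
      exact hx' (mem_biUnion hg hne)
    obtain ⟨k, hk, hne⟩ := mem_groupSupport.1 hx
    apply hne
    refine Subgroup.closure_induction (p := fun g _ => g x = x) hfix rfl ?_ ?_ hk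
    · intro a b _ _ ha hb
      rw [Homeomorph.mul_apply, hb, ha]
    · intro a _ ha
      nth_rewrite 1 [← ha]
      exact homeo_inv_apply_self a x
  · intro x hx
    simp only [mem_iUnion] at hx
    obtain ⟨g, hg, hgx⟩ := hx
    exact mem_groupSupport.2 ⟨g, Subgroup.subset_closure hg, hgx⟩

theorem isOpen_homeoSupport (f : ℝ ≃ₜ ℝ) : IsOpen (homeoSupport f) :=
  isOpen_ne_fun f.continuous continuous_id

theorem apply_mem_homeoSupport {f : ℝ ≃ₜ ℝ} {x : ℝ} (hx : x ∈ homeoSupport f) :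
    f x ∈ homeoSupport f := fun h => hx (f.injective h)

theorem pow_apply_mem_homeoSupport {f : ℝ ≃ₜ ℝ} (m : ℕ) {x : ℝ} (hx : x ∈ homeoSupport f) :
    (f ^ m) x ∈ homeoSupport f := by
  induction m with
  | zero => exact hx
  | succ m ih =>
    rw [pow_succ', Homeomorph.mul_apply]
    exact apply_mem_homeoSupport ih

theorem inv_apply_mem_homeoSupport {f : ℝ ≃ₜ ℝ} {x : ℝ} (hx : x ∈ homeoSupport f) :
    f⁻¹ x ∈ homeoSupport f := by
  intro h
  rw [homeo_apply_inv_self] at h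
  apply hx
  nth_rewrite 1 [h]
  exact homeo_apply_inv_self f x

theorem inv_pow_apply_mem_homeoSupport {f : ℝ ≃ₜ ℝ} (m : ℕ) {x : ℝ} (hx : x ∈ homeoSupport f) :
    (f ^ m)⁻¹ x ∈ homeoSupport f := by
  induction m with
  | zero => simpa using hx
  | succ m ih =>
    rw [pow_succ, mul_inv_rev, Homeomorph.mul_apply]
    exact inv_apply_mem_homeoSupport ih

theorem inv_apply_eq_of_apply_eq {f : ℝ ≃ₜ ℝ} {x : ℝ} (h : f x = x) : f⁻¹ x = x := by
  nth_rewrite 1 [← h]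
  exact homeo_inv_apply_self f x

/-- A homeomorphism that moves points to the right and has no fixed point in `[x, y]` has a power
that moves `x` beyond `y`. -/
theorem exists_lt_pow_apply {f : ℝ ≃ₜ ℝ} (hf : ∀ t, t ≤ f t) {x y : ℝ}
    (hfix : ∀ z, x ≤ z → z ≤ y → f z ≠ z) : ∃ m : ℕ, y < (f ^ m) x := by
  by_contra! hle
  have hmono : Monotone fun m : ℕ => (f ^ m) x := by
    apply monotone_nat_of_le_succ
    intro m
    rw [pow_succ', Homeomorph.mul_apply]
    exact hf _
  have hbdd : BddAbove (range fun m : ℕ => (f ^ m) x) := ⟨y, by rintro _ ⟨m, rfl⟩; exact hle m⟩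
  have hlim := tendsto_atTop_ciSup hmono hbdd
  set z := ⨆ m : ℕ, (f ^ m) x
  have h1 : Filter.Tendsto (fun m : ℕ => f ((f ^ m) x)) Filter.atTop (nhds (f z)) :=
    (f.continuous.tendsto z).comp hlim
  have h2 : Filter.Tendsto (fun m : ℕ => f ((f ^ m) x)) Filter.atTop (nhds z) := by
    have := hlim.comp (Filter.tendsto_add_atTop_nat 1)
    refine this.congr fun m => ?_
    simp only [Function.comp_apply, pow_succ', Homeomorph.mul_apply]
  exact hfix z (le_ciSup hbdd 0) (ciSup_le hle) (tendsto_nhds_unique h1 h2)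

theorem exists_inv_pow_apply_lt {f : ℝ ≃ₜ ℝ} (hf : f ∈ HomeoPlus) (hle : ∀ t, t ≤ f t) {x y : ℝ}
    (hfix : ∀ z, x ≤ z → z ≤ y → f z ≠ z) : ∃ m : ℕ, (f ^ m)⁻¹ y < x := by
  obtain ⟨m, hm⟩ := exists_lt_pow_apply hle hfix
  refine ⟨m, ?_⟩
  have := HomeoPlus.strictMono (inv_mem (pow_mem hf m)) hm
  rwa [homeo_inv_apply_self] at this

/-! ### Normal subgroups of compressing groups -/

/-- The group `K` moves every compact subset of `I` into every nonempty open subinterval of `I`. -/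
def Compresses (K : Subgroup (ℝ ≃ₜ ℝ)) (I : Set ℝ) : Prop :=
  ∀ x ∈ I, ∀ y ∈ I, x ≤ y → ∀ u ∈ I, ∀ v ∈ I, u < v → ∃ k ∈ K, u < k x ∧ k y < v

/-- A criterion for `Compresses`: compact sets can be moved arbitrarily close to the right of a
point `p` whose orbit is dense. -/
theorem compresses_of_point {K : Subgroup (ℝ ≃ₜ ℝ)} (hK : K ≤ HomeoPlus) {I : Set ℝ} {p : ℝ}
    (hp : ∀ x ∈ I, ∀ y ∈ I, x ≤ y → ∀ ε > p, ∃ k ∈ K, p < k x ∧ k y < ε)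
    (hdense : ∀ u ∈ I, ∀ v ∈ I, u < v → ∃ k ∈ K, u < k p ∧ k p < v) : Compresses K I := by
  intro x hx y hy hxy u hu v hv huv
  obtain ⟨k, hk, huk, hkv⟩ := hdense u hu v hv huv
  have hlt : p < k⁻¹ v := by
    have := HomeoPlus.strictMono (inv_mem (hK hk)) hkv
    rwa [homeo_inv_apply_self] at this
  obtain ⟨l, hl, hlx, hly⟩ := hp x hx y hy hxy _ hlt
  refine ⟨k * l, mul_mem hk hl, ?_, ?_⟩
  · rw [Homeomorph.mul_apply]
    exact huk.trans (HomeoPlus.strictMono (hK hk) hlx)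
  · rw [Homeomorph.mul_apply]
    have := HomeoPlus.strictMono (hK hk) hly
    rwa [homeo_apply_inv_self] at this

theorem commute_of_disjoint_support {g h : ℝ ≃ₜ ℝ}
    (hd : ∀ x, g x = x ∨ h x = x) : g * h = h * g := by
  ext x
  rw [Homeomorph.mul_apply, Homeomorph.mul_apply]
  by_cases hg : g x = x
  · rw [hg]
    rcases hd (h x) with h1 | h1
    · exact h1
    · rw [h.injective h1, hg]
  · have hx : h x = x := (hd x).resolve_left hg
    rw [hx]
    rcases hd (g x) with h1 | h1
    · exact absurd (g.injective h1) hg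
    · exact h1.symm

/-- In a compressing group `K`, every nontrivial subgroup normalised by `K` contains the commutators
of the compactly supported elements of `K`. -/
theorem commutator_mem_of_compresses {K N : Subgroup (ℝ ≃ₜ ℝ)} (hK : K ≤ HomeoPlus)
    (hN : N ≤ HomeoPlus) {I : Set ℝ} (hc : Compresses K I)
    (hnorm : ∀ k ∈ K, ∀ g ∈ N, k * g * k⁻¹ ∈ N) {g : ℝ ≃ₜ ℝ} (hg : g ∈ N) {z : ℝ} (hz : z ∈ I)
    (hgI : g z ∈ I) (hgz : g z ≠ z) {h₁ h₂ : ℝ ≃ₜ ℝ} (hh₁ : h₁ ∈ K) (hh₂ : h₂ ∈ K) {x y : ℝ}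
    (hx : x ∈ I) (hy : y ∈ I) (hs₁ : ∀ t, t < x ∨ y < t → h₁ t = t)
    (hs₂ : ∀ t, t < x ∨ y < t → h₂ t = t) : h₁ * h₂ * h₁⁻¹ * h₂⁻¹ ∈ N := by
  rcases lt_or_ge y x with hyx | hxy
  · have : h₁ = 1 := by
      ext t
      apply hs₁
      rcases lt_or_ge t x with h | h
      · exact Or.inl h
      · exact Or.inr (hyx.trans_le h)
    simp [this]
  -- an interval that is moved off itself
  obtain ⟨u, hu, v, hv, huv, hoff⟩ : ∃ u ∈ I, ∃ v ∈ I, u < v ∧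
      ∀ t, u < t → t < v → ¬ (u < g⁻¹ t ∧ g⁻¹ t < v) := by
    have hmono := HomeoPlus.strictMono (hN hg)
    rcases lt_or_gt_of_ne hgz with h | h
    · refine ⟨g z, hgI, z, hz, h, fun t ht ht' hc => ?_⟩
      have := hmono hc.2
      rw [homeo_apply_inv_self] at this
      exact lt_asymm ht this
    · refine ⟨z, hz, g z, hgI, h, fun t ht ht' hc => ?_⟩
      have := hmono hc.1
      rw [homeo_apply_inv_self] at this
      exact lt_asymm ht' this
  obtain ⟨k, hk, hkx, hky⟩ := hc x hx y hy hxy u hu v hv huv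
  have hkm := HomeoPlus.strictMono (hK hk)
  have hsupp : ∀ h : ℝ ≃ₜ ℝ, (∀ t, t < x ∨ y < t → h t = t) →
      ∀ t, ¬ (u < t ∧ t < v) → (k * h * k⁻¹) t = t := by
    intro h hh t ht
    rw [Homeomorph.mul_apply, Homeomorph.mul_apply, hh, homeo_apply_inv_self]
    by_contra! hcon
    apply ht
    have h1 := hkm.monotone hcon.1
    have h2 := hkm.monotone hcon.2
    rw [homeo_apply_inv_self] at h1 h2
    exact ⟨hkx.trans_le h1, h2.trans_lt hky⟩
  -- The conjugates a and b are supported in (u, v), which g moves off itself, so g a⁻¹ g⁻¹ commutes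
  -- with b. Therefore [a, b] = [a g a⁻¹ g⁻¹, b], and the first entry of the latter is in N.
  set a := k * h₁ * k⁻¹ with ha
  set b := k * h₂ * k⁻¹ with hb
  have haK : a ∈ K := mul_mem (mul_mem hk hh₁) (inv_mem hk)
  have hbK : b ∈ K := mul_mem (mul_mem hk hh₂) (inv_mem hk)
  have hcomm : (g * a⁻¹ * g⁻¹) * b = b * (g * a⁻¹ * g⁻¹) := by
    apply commute_of_disjoint_support
    intro t
    by_cases ht : u < t ∧ t < v
    · left
      have := hsupp h₁ hs₁ _ (hoff t ht.1 ht.2)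
      rw [Homeomorph.mul_apply, Homeomorph.mul_apply, inv_apply_eq_of_apply_eq this,
        homeo_apply_inv_self]
    · right
      exact hsupp h₂ hs₂ t ht
  have hn : a * (g * a⁻¹ * g⁻¹) ∈ N := by
    have := mul_mem (hnorm a haK g hg) (inv_mem hg)
    simpa [mul_assoc] using this
  have hab : a * b * a⁻¹ * b⁻¹ ∈ N := by
    have h1 := mul_mem hn (hnorm b hbK _ (inv_mem hn))
    convert h1 using 1
    have : b * (a * (g * a⁻¹ * g⁻¹))⁻¹ * b⁻¹
        = (g * a⁻¹ * g⁻¹)⁻¹ * b * a⁻¹ * b⁻¹ := by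
      have h2 : b * (g * a⁻¹ * g⁻¹)⁻¹ = (g * a⁻¹ * g⁻¹)⁻¹ * b := by
        rw [eq_inv_mul_iff_mul_eq, ← mul_assoc, hcomm]
        group
      rw [mul_inv_rev, ← mul_assoc, h2]
    rw [this]
    group
  have := hnorm k⁻¹ (inv_mem hk) _ hab
  convert this using 1
  rw [ha, hb]
  group

/-! ### Thompson's group -/

/-- Homomorphic images commute as soon as the images of the generators do. -/
theorem commute_of_generators {M Q : Type*} [Group M] [Group Q] {S : Set M}
    (φ : Subgroup.closure S →* Q)
    (h : ∀ s (hs : s ∈ S) t (ht : t ∈ S), Commute (φ ⟨s, Subgroup.subset_closure hs⟩)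
      (φ ⟨t, Subgroup.subset_closure ht⟩)) (x y : Subgroup.closure S) : Commute (φ x) (φ y) := by
  have hgen : ∀ q : Q, (∀ s (hs : s ∈ S), Commute (φ ⟨s, Subgroup.subset_closure hs⟩) q) →
      ∀ z : Subgroup.closure S, Commute (φ z) q := by
    rintro q hq ⟨z, hz⟩
    refine Subgroup.closure_induction (p := fun g hg => Commute (φ ⟨g, hg⟩) q) hq ?_ ?_ ?_ hz
    · have : (⟨1, one_mem _⟩ : Subgroup.closure S) = 1 := rfl
      rw [this, map_one]
      exact Commute.one_left q
    · intro g k hg hk h1 h2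
      have : (⟨g * k, mul_mem hg hk⟩ : Subgroup.closure S) = ⟨g, hg⟩ * ⟨k, hk⟩ := rfl
      rw [this, map_mul]
      exact h1.mul_left h2
    · intro g hg h1
      have : (⟨g⁻¹, inv_mem hg⟩ : Subgroup.closure S) = ⟨g, hg⟩⁻¹ := rfl
      rw [this, map_inv]
      exact h1.inv_left
  exact hgen _ (fun s hs => (hgen _ (fun t ht => (h s hs t ht).symm) y).symm) x

/-- The algebra behind the perfectness of `F'`. -/
theorem commute_of_shift_relations {Q : Type*} [Group Q] (a b : Q) (s : ℤ → Q)
    (hs : ∀ i, s i = a ^ i * b * a ^ (-i))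
    (hrel : ∀ i j, i < j → s i * s j * (s i)⁻¹ = s (j + 1))
    (hcomm : Commute (s 1 * (s 3)⁻¹) (s 1 * (s 6)⁻¹)) : Commute a b := by
  -- Both s 1 and s 3 conjugate s 5 to s 6, so s 1 (s 3)⁻¹ centralises s 6. With the hypothesis it
  -- then centralises s 1, hence s 3 commutes with s 1.
  have h6 : Commute (s 1 * (s 3)⁻¹) (s 6) := by
    have h3 : s 3 * s 5 * (s 3)⁻¹ = s 6 := hrel 3 5 (by norm_num)
    have h1 : s 1 * s 5 * (s 1)⁻¹ = s 6 := hrel 1 5 (by norm_num)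
    have h3' : (s 3)⁻¹ * s 6 = s 5 * (s 3)⁻¹ := by rw [← h3]; group
    have h1' : s 1 * s 5 = s 6 * s 1 := by rw [← h1]; group
    show s 1 * (s 3)⁻¹ * s 6 = s 6 * (s 1 * (s 3)⁻¹)
    rw [mul_assoc, h3', ← mul_assoc, h1', mul_assoc]
  have h1 : Commute (s 1 * (s 3)⁻¹) (s 1) := by
    simpa using hcomm.mul_right h6
  have h13 : Commute (s 3) (s 1) := by
    have h2 : Commute ((s 1)⁻¹ * (s 1 * (s 3)⁻¹)) (s 1) :=
      ((Commute.refl (s 1)).inv_left).mul_left h1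
    simpa using h2
  -- Conjugation by s 1 sends s 3 to s 4 and now fixes s 3. Conjugating s 3 = s 4 back by a³ gives b
  -- = a b a⁻¹.
  have h34 : s 3 = s 4 := by
    have := hrel 1 3 (by norm_num)
    rw [← h13.eq, mul_inv_cancel_right] at this
    exact this
  have h01 : b = a * b * a⁻¹ := by
    rw [hs 3, hs 4] at h34
    have : a ^ (-3 : ℤ) * (a ^ (3 : ℤ) * b * a ^ (-3 : ℤ)) * a ^ (3 : ℤ)
        = a ^ (-3 : ℤ) * (a ^ (4 : ℤ) * b * a ^ (-4 : ℤ)) * a ^ (3 : ℤ) := by rw [h34]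
    group at this
    nth_rewrite 1 [this]
    group
  show a * b = b * a
  nth_rewrite 2 [h01]
  group

theorem thompsonA_mem : thompsonA ∈ ThompsonF := Subgroup.subset_closure (by simp)

theorem thompsonB_mem : thompsonB ∈ ThompsonF := Subgroup.subset_closure (by simp)

theorem thompsonA_apply (x : ℝ) : thompsonA x = x + 1 := rfl

theorem thompsonB_apply (x : ℝ) :
    thompsonB x = if x ≤ 0 then x else if x < 1 then 2 * x else x + 1 := rfl

theorem thompsonA_zpow_apply (i : ℤ) (x : ℝ) : (thompsonA ^ i) x = x + i := by
  induction i using Int.induction_on generalizing x with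
  | zero => simp
  | succ i ih =>
    rw [zpow_add_one, Homeomorph.mul_apply, ih, thompsonA_apply]
    push_cast
    ring
  | pred i ih =>
    rw [zpow_sub_one, Homeomorph.mul_apply, ih]
    have : thompsonA⁻¹ x = x - 1 := by
      apply thompsonA.injective
      rw [homeo_apply_inv_self, thompsonA_apply]
      ring
    rw [this]
    push_cast
    ring

/-- The conjugates `aⁱ b a⁻ⁱ`. -/
noncomputable def thompsonShift (i : ℤ) : ℝ ≃ₜ ℝ :=
  thompsonA ^ i * thompsonB * thompsonA ^ (-i)

theorem thompsonShift_apply (i : ℤ) (x : ℝ) :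
    thompsonShift i x = thompsonB (x - i) + i := by
  rw [thompsonShift, Homeomorph.mul_apply, Homeomorph.mul_apply, thompsonA_zpow_apply,
    thompsonA_zpow_apply]
  push_cast
  rw [sub_eq_add_neg]

theorem thompsonShift_mem (i : ℤ) : thompsonShift i ∈ ThompsonF :=
  mul_mem (mul_mem (zpow_mem thompsonA_mem _) thompsonB_mem) (zpow_mem thompsonA_mem _)

theorem thompsonShift_of_le {i : ℤ} {x : ℝ} (h : x ≤ i) : thompsonShift i x = x := by
  rw [thompsonShift_apply, thompsonB_apply, if_pos (by linarith)]
  ring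

theorem thompsonShift_of_ge {i : ℤ} {x : ℝ} (h : i + 1 ≤ x) : thompsonShift i x = x + 1 := by
  rw [thompsonShift_apply, thompsonB_apply, if_neg (by linarith), if_neg (by linarith)]
  ring

theorem thompsonB_mem_homeoPlus : thompsonB ∈ HomeoPlus := by
  intro x y hxy
  show thompsonB x < thompsonB y
  rw [thompsonB_apply, thompsonB_apply]
  split_ifs <;> linarith

theorem thompsonA_mem_homeoPlus : thompsonA ∈ HomeoPlus := fun x y hxy => by
  show thompsonA x < thompsonA y
  rw [thompsonA_apply, thompsonA_apply]
  linarith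

theorem thompsonF_le : ThompsonF ≤ HomeoPlus := by
  rw [ThompsonF, Subgroup.closure_le]
  rintro g (rfl | rfl)
  · exact thompsonA_mem_homeoPlus
  · exact thompsonB_mem_homeoPlus

/-- To the right of i + 1 ≤ j the i-th map is translation by 1, so on the support of the j-th one it
conjugates exactly as a does. -/
theorem thompsonShift_rel {i j : ℤ} (hij : i < j) :
    thompsonShift i * thompsonShift j * (thompsonShift i)⁻¹ = thompsonShift (j + 1) := by
  rw [mul_inv_eq_iff_eq_mul]
  have hij' : (i : ℝ) + 1 ≤ j := by exact_mod_cast hij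
  ext x
  rw [Homeomorph.mul_apply, Homeomorph.mul_apply]
  rcases le_total x j with hx | hx
  · rw [thompsonShift_of_le hx, thompsonShift_of_le (i := j + 1)]
    push_cast
    rcases le_total x (i + 1) with h | h
    · have h1 := (HomeoPlus.strictMono (thompsonF_le (thompsonShift_mem i))).monotone h
      rw [thompsonShift_of_ge le_rfl] at h1
      linarith
    · rw [thompsonShift_of_ge h]
      linarith
  · rw [thompsonShift_of_ge (i := i) (x := x) (by linarith), thompsonShift_of_ge (i := i),
      thompsonShift_apply, thompsonShift_apply]
    · push_cast
      ring_nf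
    · have h1 := (HomeoPlus.strictMono (thompsonF_le (thompsonShift_mem j))).monotone hx
      rw [thompsonShift_of_le le_rfl] at h1
      linarith

/-- Every shift is the identity near -∞ and translation by 1 near +∞, so these quotients have
compact support. The bounds 9 and 11 are a convenient margin for the indices 1, 3, 6 used later. -/
theorem thompsonShift_div_eq_self {i j : ℤ} (hi : 0 ≤ i) (hi' : i < 9) (hj : 0 ≤ j) (hj' : j < 9)
    {t : ℝ} (ht : t < 0 ∨ 11 < t) : (thompsonShift i * (thompsonShift j)⁻¹) t = t := by
  have hi1 : (0 : ℝ) ≤ i := by exact_mod_cast hi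
  have hj1 : (0 : ℝ) ≤ j := by exact_mod_cast hj
  have hi2 : (i : ℝ) < 9 := by exact_mod_cast hi'
  have hj2 : (j : ℝ) < 9 := by exact_mod_cast hj'
  rw [Homeomorph.mul_apply]
  rcases ht with ht | ht
  · rw [inv_apply_eq_of_apply_eq (thompsonShift_of_le (by linarith)),
      thompsonShift_of_le (by linarith)]
  · have : (thompsonShift j)⁻¹ t = t - 1 := by
      apply (thompsonShift j).injective
      rw [homeo_apply_inv_self, thompsonShift_of_ge (by linarith)]
      ring
    rw [this, thompsonShift_of_ge (by linarith)]
    ring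

/-- Two homomorphic images of elements of `F` commute as soon as two specific commuting relations
hold. -/
theorem thompsonF_hom_commute {Q : Type*} [Group Q] (φ : ThompsonF →* Q)
    (h : Commute (φ ⟨thompsonShift 1 * (thompsonShift 3)⁻¹,
        mul_mem (thompsonShift_mem 1) (inv_mem (thompsonShift_mem 3))⟩)
      (φ ⟨thompsonShift 1 * (thompsonShift 6)⁻¹,
        mul_mem (thompsonShift_mem 1) (inv_mem (thompsonShift_mem 6))⟩)) (x y : ThompsonF) :
    Commute (φ x) (φ y) := by
  set a : ThompsonF := ⟨thompsonA, thompsonA_mem⟩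
  set b : ThompsonF := ⟨thompsonB, thompsonB_mem⟩
  set s : ℤ → ThompsonF := fun i => ⟨thompsonShift i, thompsonShift_mem i⟩
  have hs : ∀ i, s i = a ^ i * b * a ^ (-i) := fun i => Subtype.ext rfl
  have hab : Commute (φ a) (φ b) := by
    refine commute_of_shift_relations _ _ (fun i => φ (s i)) ?_ ?_ ?_
    · intro i
      rw [hs, map_mul, map_mul, map_zpow, map_zpow]
    · intro i j hij
      rw [← map_mul, ← map_inv, ← map_mul]
      congr 1
      exact Subtype.ext (thompsonShift_rel hij)
    · have h1 : s 1 * (s 3)⁻¹ = ⟨thompsonShift 1 * (thompsonShift 3)⁻¹,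
        mul_mem (thompsonShift_mem 1) (inv_mem (thompsonShift_mem 3))⟩ := rfl
      have h2 : s 1 * (s 6)⁻¹ = ⟨thompsonShift 1 * (thompsonShift 6)⁻¹,
        mul_mem (thompsonShift_mem 1) (inv_mem (thompsonShift_mem 6))⟩ := rfl
      rw [← h1, ← h2, map_mul, map_mul, map_inv, map_inv] at h
      exact h
  refine commute_of_generators φ ?_ x y
  rintro u hu v hv
  rcases hu with rfl | rfl <;> rcases hv with rfl | rfl
  · exact Commute.refl _
  · exact hab
  · exact hab.symm
  · exact Commute.refl _

/-- `F'` is perfect: a homomorphism whose restriction to `F'` has commutative image has itself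
commutative image. -/
theorem thompsonF_hom_commute_of_commutator {Q : Type*} [Group Q] (φ : ThompsonF →* Q)
    (h : ∀ u ∈ commutator ThompsonF, ∀ v ∈ commutator ThompsonF, Commute (φ u) (φ v))
    (x y : ThompsonF) : Commute (φ x) (φ y) := by
  -- The quotient is the commutator [s 1, aᵏ]; k = 2 and k = 5 give the indices 3 and 6 required by
  -- `thompsonF_hom_commute`.
  have key : ∀ k : ℤ, (⟨thompsonShift 1 * (thompsonShift (1 + k))⁻¹,
      mul_mem (thompsonShift_mem 1) (inv_mem (thompsonShift_mem (1 + k)))⟩ : ThompsonF)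
        ∈ commutator ThompsonF := by
    intro k
    have : (⟨thompsonShift 1 * (thompsonShift (1 + k))⁻¹,
      mul_mem (thompsonShift_mem 1) (inv_mem (thompsonShift_mem (1 + k)))⟩ : ThompsonF)
        = ⁅(⟨thompsonShift 1, thompsonShift_mem 1⟩ : ThompsonF),
            ⟨thompsonA ^ k, zpow_mem thompsonA_mem k⟩⁆ := by
      apply Subtype.ext
      simp only [thompsonShift, commutatorElement_def, Subgroup.coe_mul, Subgroup.coe_inv]
      group
    rw [this]
    exact Subgroup.commutator_mem_commutator (Subgroup.mem_top _) (Subgroup.mem_top _)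
  exact thompsonF_hom_commute φ (h _ (key 2) _ (key 5)) x y

theorem thompsonB_inv_apply {x : ℝ} (h0 : 0 ≤ x) (h2 : x ≤ 2) : thompsonB⁻¹ x = x / 2 := by
  apply thompsonB.injective
  rw [homeo_apply_inv_self, thompsonB_apply]
  split_ifs <;> linarith

/-- Induction on the exponent of the denominator: subtract the integer part, reach twice the
remainder by induction, halve it with b⁻¹ (which is x / 2 on [0, 2]) and translate back. -/
theorem thompsonF_orbit_dyadic (m : ℕ) (j : ℤ) : ∃ k ∈ ThompsonF, k 0 = (j : ℝ) / 2 ^ m := by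
  induction m generalizing j with
  | zero => exact ⟨thompsonA ^ j, zpow_mem thompsonA_mem j, by simp [thompsonA_zpow_apply]⟩
  | succ m ih =>
    set l : ℤ := ⌊(j : ℝ) / 2 ^ (m + 1)⌋ with hl
    obtain ⟨k, hk, hk0⟩ := ih (j - l * 2 ^ (m + 1))
    refine ⟨thompsonA ^ l * thompsonB⁻¹ * k,
      mul_mem (mul_mem (zpow_mem thompsonA_mem l) (inv_mem thompsonB_mem)) hk, ?_⟩
    have h1 := Int.floor_le ((j : ℝ) / 2 ^ (m + 1))
    have h2 := Int.lt_floor_add_one ((j : ℝ) / 2 ^ (m + 1))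
    rw [← hl] at h1 h2
    have hpow : (0 : ℝ) < 2 ^ m := by positivity
    have heq : k 0 = 2 * ((j : ℝ) / 2 ^ (m + 1) - l) := by
      rw [hk0]
      push_cast
      field_simp
      ring
    rw [Homeomorph.mul_apply, Homeomorph.mul_apply, thompsonB_inv_apply (by linarith)
      (by linarith), thompsonA_zpow_apply, heq]
    ring

/-- Here 0 is the contracting point: a compact set is translated into (0, ∞) and then shrunk towards
0 by powers of b⁻¹. The orbit of 0 contains the dyadic rationals, hence is dense. -/
theorem thompsonF_compresses : Compresses ThompsonF univ := by
  apply compresses_of_point thompsonF_le (p := 0)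
  · intro x _ y _ hxy ε hε
    obtain ⟨l, hl⟩ := exists_int_gt (-x)
    have hx : 0 < (thompsonA ^ l) x := by
      rw [thompsonA_zpow_apply]
      linarith
    have hB : ∀ t, t ≤ thompsonB t := by
      intro t
      rw [thompsonB_apply]
      split_ifs <;> linarith
    obtain ⟨m, hm⟩ := exists_inv_pow_apply_lt thompsonB_mem_homeoPlus hB (x := ε)
      (y := (thompsonA ^ l) y) (by
        intro z hz _
        rw [thompsonB_apply]
        split_ifs <;> linarith)
    have hm' : (thompsonB ^ m)⁻¹ ∈ ThompsonF := inv_mem (pow_mem thompsonB_mem m)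
    refine ⟨(thompsonB ^ m)⁻¹ * thompsonA ^ l, mul_mem hm' (zpow_mem thompsonA_mem l), ?_, hm⟩
    rw [Homeomorph.mul_apply]
    have h0 : (thompsonB ^ m)⁻¹ 0 = 0 := by
      apply inv_apply_eq_of_apply_eq
      clear hm hm'
      induction m with
      | zero => rfl
      | succ m ih =>
        rw [pow_succ, Homeomorph.mul_apply]
        have : thompsonB 0 = 0 := by simp [thompsonB_apply]
        rw [this, ih]
    have := HomeoPlus.strictMono (thompsonF_le hm') hx
    rwa [h0] at this
  · intro u _ v _ huv
    obtain ⟨m, hm⟩ := exists_pow_lt_of_lt_one (sub_pos.2 huv) (by norm_num : (1 / 2 : ℝ) < 1)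
    obtain ⟨k, hk, hk0⟩ := thompsonF_orbit_dyadic m (⌊u * 2 ^ m⌋ + 1)
    refine ⟨k, hk, ?_, ?_⟩
    · rw [hk0, lt_div_iff₀ (by positivity)]
      push_cast
      exact Int.lt_floor_add_one _
    · rw [hk0, div_lt_iff₀ (by positivity)]
      push_cast
      have h1 := Int.floor_le (u * 2 ^ m)
      rw [div_pow, one_pow, div_lt_iff₀ (by positivity)] at hm
      linarith

/-- Every proper quotient of `F` is abelian. -/
theorem thompsonF_hom_commute_of_not_injective {Q : Type*} [Group Q] (φ : ThompsonF →* Q)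
    (h : ¬ Function.Injective φ) (x y : ThompsonF) : Commute (φ x) (φ y) := by
  rw [← MonoidHom.ker_eq_bot_iff, Subgroup.eq_bot_iff_forall] at h
  push Not at h
  obtain ⟨g, hg, hg1⟩ := h
  obtain ⟨z, hz⟩ : ∃ z, (g : ℝ ≃ₜ ℝ) z ≠ z := by
    by_contra! hc
    exact hg1 (Subtype.ext (Homeomorph.ext hc))
  apply thompsonF_hom_commute
  -- The two elements of `thompsonF_hom_commute` are supported in [0, 11], so Higman's argument puts
  -- their commutator into the kernel.
  have := commutator_mem_of_compresses (N := φ.ker.map ThompsonF.subtype) thompsonF_le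
    (fun _ hg => by obtain ⟨g, _, rfl⟩ := hg; exact thompsonF_le g.2) thompsonF_compresses ?_ (Subgroup.mem_map_of_mem _ hg) (mem_univ z) (mem_univ _) hz
    (mul_mem (thompsonShift_mem 1) (inv_mem (thompsonShift_mem 3)))
    (mul_mem (thompsonShift_mem 1) (inv_mem (thompsonShift_mem 6)))
    (mem_univ 0) (mem_univ 11)
    (fun t ht => thompsonShift_div_eq_self (by norm_num) (by norm_num) (by norm_num) (by norm_num)
      ht)
    (fun t ht => thompsonShift_div_eq_self (by norm_num) (by norm_num) (by norm_num) (by norm_num)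
      ht)
  · obtain ⟨w, hw, hwe⟩ := this
    set u : ThompsonF := ⟨thompsonShift 1 * (thompsonShift 3)⁻¹,
        mul_mem (thompsonShift_mem 1) (inv_mem (thompsonShift_mem 3))⟩
    set v : ThompsonF := ⟨thompsonShift 1 * (thompsonShift 6)⁻¹,
        mul_mem (thompsonShift_mem 1) (inv_mem (thompsonShift_mem 6))⟩
    have hw' : w = u * v * u⁻¹ * v⁻¹ := Subtype.ext hwe
    rw [hw', SetLike.mem_coe, MonoidHom.mem_ker, map_mul, map_mul, map_mul, map_inv, map_inv,
      mul_inv_eq_one, mul_inv_eq_iff_eq_mul] at hw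
    exact hw
  · rintro k hk _ ⟨w, hw, rfl⟩
    exact ⟨⟨k, hk⟩ * w * ⟨k, hk⟩⁻¹, φ.normal_ker.conj_mem w hw ⟨k, hk⟩, rfl⟩

/-! ### The dynamics of a prechain group -/

section Chain

variable {n : ℕ} {f : Fin n → (ℝ ≃ₜ ℝ)}

theorem IsPrechain.chainGroup_le (hf : IsPrechain f) : chainGroup f ≤ HomeoPlus := by
  rw [chainGroup, Subgroup.closure_le]
  rintro _ ⟨i, rfl⟩
  exact hf.mem_homeoPlus i

theorem generator_mem (f : Fin n → (ℝ ≃ₜ ℝ)) (i : Fin n) : f i ∈ chainGroup f :=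
  Subgroup.subset_closure (mem_range_self i)

theorem mem_groupSupport_chainGroup {x : ℝ} :
    x ∈ groupSupport (chainGroup f) ↔ ∃ i, x ∈ homeoSupport (f i) := by
  rw [chainGroup, groupSupport_closure]
  simp

theorem isOpen_groupSupport_chainGroup : IsOpen (groupSupport (chainGroup f)) := by
  rw [chainGroup, groupSupport_closure]
  exact isOpen_biUnion fun g _ => isOpen_homeoSupport g

theorem mem_groupSupport_of_mem {i : Fin n} {x : ℝ} (hx : x ∈ homeoSupport (f i)) :
    x ∈ groupSupport (chainGroup f) := mem_groupSupport_chainGroup.2 ⟨i, hx⟩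

theorem IsPrechain.exists_lt_support (hf : IsPrechain f) {i k : Fin n} (hik : (i : ℕ) + 1 = k) :
    ∃ x ∈ homeoSupport (f i), ∀ y ∈ homeoSupport (f k), x < y := by
  obtain ⟨_, ⟨x, hx, rfl⟩, hlt⟩ := sInf_lt_iff.1 (hf.supports.leftEnd_lt i k hik)
  refine ⟨x, hx, fun y hy => ?_⟩
  have : leftEnd (homeoSupport (f k)) ≤ (y : EReal) := sInf_le (mem_image_of_mem _ hy)
  exact EReal.coe_lt_coe_iff.1 (hlt.trans_le this)

/-- A point of J_k outside J_i lies to the right of some point of J_i; convexity of J_i then puts it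
beyond all of J_i. -/
theorem IsPrechain.exists_gt_support (hf : IsPrechain f) {i k : Fin n} (hik : (i : ℕ) + 1 = k) :
    ∃ y ∈ homeoSupport (f k), ∀ x ∈ homeoSupport (f i), x < y := by
  obtain ⟨x₀, hx₀, hlt⟩ := hf.exists_lt_support hik
  obtain ⟨y, hy, hyn⟩ := exists_of_ssubset (hf.supports.inter_ssubset_right i k hik)
  refine ⟨y, hy, fun x hx => ?_⟩
  by_contra! hle
  exact hyn ⟨(hf.supports.ordConnected i).out hx₀ hx ⟨(hlt y hy).le, hle⟩, hy⟩

theorem IsPrechain.lt_apply (hf : IsPrechain f) {i : Fin n} {x : ℝ}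
    (hx : x ∈ homeoSupport (f i)) : x < f i x := lt_of_le_of_ne (hf.le_apply i x) (Ne.symm hx)

theorem IsPrechain.inv_apply_lt (hf : IsPrechain f) {i : Fin n} {x : ℝ}
    (hx : x ∈ homeoSupport (f i)) : (f i)⁻¹ x < x := by
  have h := hf.lt_apply (inv_apply_mem_homeoSupport hx)
  rwa [homeo_apply_inv_self] at h

theorem IsPrechain.exists_gt_last (hf : IsPrechain f) {l : Fin n} (hl : (l : ℕ) + 1 = n) {x : ℝ}
    (hx : x ∈ groupSupport (chainGroup f)) : ∃ y ∈ homeoSupport (f l), x < y := by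
  obtain ⟨i, hi⟩ := mem_groupSupport_chainGroup.1 hx
  have key : ∀ d : ℕ, ∀ i : Fin n, (i : ℕ) + d = l → ∀ x ∈ homeoSupport (f i),
      ∃ y ∈ homeoSupport (f l), x < y := by
    intro d
    induction d with
    | zero =>
      intro i hi x hx
      obtain rfl : i = l := Fin.ext hi
      exact ⟨f i x, apply_mem_homeoSupport hx, hf.lt_apply hx⟩
    | succ d ih =>
      intro i hi x hx
      have hk : (i : ℕ) + 1 < n := by omega
      obtain ⟨y, hy, hlt⟩ := hf.exists_gt_support (k := ⟨i + 1, hk⟩) rfl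
      obtain ⟨z, hz, hyz⟩ := ih ⟨i + 1, hk⟩ (by simp only; omega) y hy
      exact ⟨z, hz, (hlt x hx).trans hyz⟩
  have := i.isLt
  exact key (l - i) i (by omega) x hi

theorem IsPrechain.exists_lt_first (hf : IsPrechain f) {l : Fin n} (hl : (l : ℕ) = 0) {x : ℝ}
    (hx : x ∈ groupSupport (chainGroup f)) : ∃ y ∈ homeoSupport (f l), y < x := by
  obtain ⟨i, hi⟩ := mem_groupSupport_chainGroup.1 hx
  have key : ∀ d : ℕ, ∀ i : Fin n, (i : ℕ) = d → ∀ x ∈ homeoSupport (f i),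
      ∃ y ∈ homeoSupport (f l), y < x := by
    intro d
    induction d with
    | zero =>
      intro i hi x hx
      obtain rfl : i = l := Fin.ext (hi.trans hl.symm)
      exact ⟨(f i)⁻¹ x, inv_apply_mem_homeoSupport hx, hf.inv_apply_lt hx⟩
    | succ d ih =>
      intro i hi x hx
      have hk : d < n := by omega
      obtain ⟨y, hy, hlt⟩ := hf.exists_lt_support (i := ⟨d, hk⟩) hi.symm
      obtain ⟨z, hz, hyz⟩ := ih ⟨d, hk⟩ rfl y hy
      exact ⟨z, hz, hyz.trans (hlt x hx)⟩
  exact key i i rfl x hi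

theorem IsPrechain.mem_last_of_le (hf : IsPrechain f) {l : Fin n} (hl : (l : ℕ) + 1 = n) {x y : ℝ}
    (hx : x ∈ homeoSupport (f l)) (hy : y ∈ groupSupport (chainGroup f)) (hxy : x ≤ y) :
    y ∈ homeoSupport (f l) := by
  obtain ⟨z, hz, hyz⟩ := hf.exists_gt_last hl hy
  exact (hf.supports.ordConnected l).out hx hz ⟨hxy, hyz.le⟩

/-- A point z missed by all supports but to the right of a support point would have J_1 on its left.
Since consecutive intervals overlap, all the J_i would then lie to its left. -/
theorem IsPrechain.ordConnected_support (hf : IsPrechain f) :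
    (groupSupport (chainGroup f)).OrdConnected := by
  refine ⟨fun x hx y hy z hz => ?_⟩
  by_contra hzn
  have hn : ∀ i, z ∉ homeoSupport (f i) := fun i hi => hzn (mem_groupSupport_of_mem hi)
  obtain ⟨j, hj⟩ := mem_groupSupport_chainGroup.1 hy
  have hn0 : 0 < n := j.pos
  obtain ⟨x', hx', hxx⟩ := hf.exists_lt_first (l := ⟨0, hn0⟩) rfl hx
  have key : ∀ m : ℕ, ∀ k : Fin n, (k : ℕ) = m → ∀ w ∈ homeoSupport (f k), w < z := by
    intro m
    induction m with
    | zero =>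
      intro k hk w hw
      obtain rfl : k = ⟨0, hn0⟩ := Fin.ext hk
      by_contra! hle
      exact hn _ ((hf.supports.ordConnected _).out hx' hw ⟨hxx.le.trans hz.1, hle⟩)
    | succ m ih =>
      intro k hk w hw
      have hm : m < n := by omega
      obtain ⟨v, hv, hv'⟩ := hf.supports.inter_nonempty ⟨m, hm⟩ k hk.symm
      by_contra! hle
      exact hn _ ((hf.supports.ordConnected _).out hv' hw ⟨(ih ⟨m, hm⟩ rfl v hv).le, hle⟩)
  exact absurd (key j j rfl y hj) (not_lt.2 hz.2)

theorem IsPrechain.exists_pow_gt (hf : IsPrechain f) {i : Fin n} {x y : ℝ}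
    (hx : x ∈ homeoSupport (f i)) (hy : y ∈ homeoSupport (f i)) : ∃ m : ℕ, y < ((f i) ^ m) x :=
  exists_lt_pow_apply (hf.le_apply i) fun _ h h' =>
    (hf.supports.ordConnected i).out hx hy ⟨h, h'⟩

theorem IsPrechain.exists_inv_pow_lt (hf : IsPrechain f) {i : Fin n} {x y : ℝ}
    (hx : x ∈ homeoSupport (f i)) (hy : y ∈ homeoSupport (f i)) :
    ∃ m : ℕ, ((f i) ^ m)⁻¹ x < y :=
  exists_inv_pow_apply_lt (hf.mem_homeoPlus i) (hf.le_apply i) fun _ h h' =>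
    (hf.supports.ordConnected i).out hy hx ⟨h, h'⟩

/-- The orbit of every point of the support meets the support of every generator. -/
theorem IsPrechain.exists_apply_mem (hf : IsPrechain f) {x : ℝ}
    (hx : x ∈ groupSupport (chainGroup f)) (j : Fin n) :
    ∃ g ∈ chainGroup f, g x ∈ homeoSupport (f j) := by
  have up : ∀ i k : Fin n, (i : ℕ) + 1 = k → (∃ g ∈ chainGroup f, g x ∈ homeoSupport (f i)) →
      ∃ g ∈ chainGroup f, g x ∈ homeoSupport (f k) := by
    rintro i k hik ⟨g, hg, hgx⟩
    obtain ⟨z, hz, hz'⟩ := hf.supports.inter_nonempty i k hik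
    obtain ⟨y, hy, hlt⟩ := hf.exists_gt_support hik
    -- Powers of f i carry the point past z ∈ J_i ∩ J_k but never out of J_i, so it stays below y ∈
    -- J_k and has landed in J_k.
    obtain ⟨m, hm⟩ := hf.exists_pow_gt hgx hz
    refine ⟨f i ^ m * g, mul_mem (pow_mem (generator_mem f i) m) hg, ?_⟩
    exact (hf.supports.ordConnected k).out hz' hy
      ⟨hm.le, (hlt _ (pow_apply_mem_homeoSupport m hgx)).le⟩
  have down : ∀ i k : Fin n, (i : ℕ) + 1 = k → (∃ g ∈ chainGroup f, g x ∈ homeoSupport (f k)) →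
      ∃ g ∈ chainGroup f, g x ∈ homeoSupport (f i) := by
    rintro i k hik ⟨g, hg, hgx⟩
    obtain ⟨z, hz, hz'⟩ := hf.supports.inter_nonempty i k hik
    obtain ⟨y, hy, hlt⟩ := hf.exists_lt_support hik
    obtain ⟨m, hm⟩ := hf.exists_inv_pow_lt hgx hz'
    refine ⟨(f k ^ m)⁻¹ * g, mul_mem (inv_mem (pow_mem (generator_mem f k) m)) hg, ?_⟩
    exact (hf.supports.ordConnected i).out hy hz
      ⟨(hlt _ (inv_pow_apply_mem_homeoSupport m hgx)).le, hm.le⟩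
  have key : ∀ m : ℕ, ∀ hm : m < n, (∃ g ∈ chainGroup f, g x ∈ homeoSupport (f ⟨m, hm⟩)) ↔
      ∃ g ∈ chainGroup f, g x ∈ homeoSupport (f ⟨0, j.pos⟩) := by
    intro m
    induction m with
    | zero => exact fun _ => Iff.rfl
    | succ m ih =>
      intro hm
      rw [← ih (by omega)]
      exact ⟨down _ _ rfl, up _ _ rfl⟩
  obtain ⟨i, hi⟩ := mem_groupSupport_chainGroup.1 hx
  exact (key j j.isLt).2 ((key i i.isLt).1 ⟨1, one_mem _, hi⟩)

/-- There is a point of the support to whose right every compact subset of the support can be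
contracted. -/
theorem IsPrechain.exists_contracting_point (hf : IsPrechain f) (hn : 2 ≤ n) :
    ∃ p ∈ groupSupport (chainGroup f), ∀ x ∈ groupSupport (chainGroup f),
      ∀ y ∈ groupSupport (chainGroup f), x ≤ y → ∀ ε > p,
        ∃ k ∈ chainGroup f, p < k x ∧ k y < ε := by
  set i : Fin n := ⟨n - 2, by omega⟩
  set l : Fin n := ⟨n - 1, by omega⟩
  have hil : (i : ℕ) + 1 = l := by simp only [i, l]; omega
  have hl : (l : ℕ) + 1 = n := by simp only [l]; omega
  obtain ⟨a, ha, hlt⟩ := hf.exists_lt_support hil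
  obtain ⟨z, hz, hz'⟩ := hf.supports.inter_nonempty i l hil
  have hbdd : BddBelow (homeoSupport (f l)) := ⟨a, fun y hy => (hlt y hy).le⟩
  -- The last interval is nonempty and bounded below by a point of its predecessor, so the real
  -- `sInf` is its true left end, and p lies in the predecessor's support.
  set p := sInf (homeoSupport (f l)) with hp
  have hpi : p ∈ homeoSupport (f i) := (hf.supports.ordConnected i).out ha hz
    ⟨le_csInf ⟨z, hz'⟩ fun y hy => (hlt y hy).le, csInf_le hbdd hz'⟩
  have hpl : ∀ y ∈ homeoSupport (f l), p < y := by
    intro y hy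
    exact (csInf_le hbdd (inv_apply_mem_homeoSupport hy)).trans_lt (hf.inv_apply_lt hy)
  refine ⟨p, mem_groupSupport_of_mem hpi, fun x hx y hy hxy ε hε => ?_⟩
  obtain ⟨g, hg, hgx⟩ := hf.exists_apply_mem hx l
  have hgy : g y ∈ homeoSupport (f l) := hf.mem_last_of_le hl hgx (apply_mem_groupSupport hg hy)
    ((HomeoPlus.strictMono (hf.chainGroup_le hg)).monotone hxy)
  obtain ⟨w, hw, hwε⟩ := exists_lt_of_csInf_lt ⟨z, hz'⟩ hε
  obtain ⟨m, hm⟩ := hf.exists_inv_pow_lt hgy hw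
  exact ⟨(f l ^ m)⁻¹ * g, mul_mem (inv_mem (pow_mem (generator_mem f l) m)) hg,
    hpl _ (inv_pow_apply_mem_homeoSupport m hgx), hm.trans hwε⟩

end Chain

/-! ### Commutators in chain groups -/

section Chain

variable {n : ℕ} {f : Fin n → (ℝ ≃ₜ ℝ)}

theorem mem_homeoSupport_of_commute {g h : ℝ ≃ₜ ℝ} (hc : Commute g h) {x : ℝ}
    (hx : x ∈ homeoSupport h) : g x ∈ homeoSupport h := by
  intro hfix
  rw [← Homeomorph.mul_apply, ← hc.eq, Homeomorph.mul_apply] at hfix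
  exact hx (g.injective hfix)

/-- If they commuted, powers of (f i)⁻¹ would preserve J_k; but some power moves a point of the
overlap to the left of all of J_k. -/
theorem IsPrechain.not_commute (hf : IsPrechain f) {i k : Fin n} (hik : (i : ℕ) + 1 = k) :
    ¬ Commute (f i) (f k) := by
  intro hc
  obtain ⟨a, ha, hlt⟩ := hf.exists_lt_support hik
  obtain ⟨z, hz, hz'⟩ := hf.supports.inter_nonempty i k hik
  obtain ⟨m, hm⟩ := hf.exists_inv_pow_lt hz ha
  exact lt_asymm hm (hlt _ (mem_homeoSupport_of_commute ((hc.pow_left m).inv_left) hz'))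

theorem IsPrechain.commute_of_lt (hf : IsPrechain f) {i k : Fin n} (hik : (i : ℕ) + 1 < k) :
    Commute (f i) (f k) := by
  apply commute_of_disjoint_support
  intro x
  by_contra! h
  have : x ∈ homeoSupport (f i) ∩ homeoSupport (f k) := h
  rw [hf.supports.disjoint i k hik] at this
  exact this

/-- The commutator subgroup of a chain group is perfect: a homomorphism whose restriction to the
commutator subgroup has commutative image has itself commutative image. -/
theorem IsChainFamily.hom_commute (hf : IsChainFamily f) {Q : Type*} [Group Q]
    (φ : chainGroup f →* Q)
    (h : ∀ u ∈ commutator (chainGroup f), ∀ v ∈ commutator (chainGroup f), Commute (φ u) (φ v))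
    (x y : chainGroup f) : Commute (φ x) (φ y) := by
  have hadj : ∀ i k : Fin n, (i : ℕ) + 1 = k → Commute (φ (chainGen f i)) (φ (chainGen f k)) := by
    intro i k hik
    obtain ⟨e⟩ := hf.thompson i k hik
    have hle : Subgroup.closure {f i, f k} ≤ chainGroup f := by
      apply Subgroup.closure_mono
      rintro _ (rfl | rfl)
      · exact mem_range_self i
      · exact mem_range_self k
    set ι : ThompsonF →* chainGroup f := (Subgroup.inclusion hle).comp e.symm.toMonoidHom
    have hι : ∀ u ∈ commutator ThompsonF, ι u ∈ commutator (chainGroup f) := by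
      intro u hu
      have h1 := Subgroup.mem_map_of_mem ι hu
      rw [commutator_def, Subgroup.map_commutator] at h1
      exact Subgroup.commutator_mono le_top le_top h1
    have key := thompsonF_hom_commute_of_commutator (φ.comp ι)
      fun u hu v hv => h _ (hι u hu) _ (hι v hv)
    have h1 := key (e ⟨f i, Subgroup.subset_closure (by simp)⟩)
      (e ⟨f k, Subgroup.subset_closure (by simp)⟩)
    have h2 : ∀ g, ι (e g) = Subgroup.inclusion hle g := fun g =>
      congrArg (Subgroup.inclusion hle) (e.symm_apply_apply g)
    change Commute (φ (ι (e _))) (φ (ι (e _))) at h1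
    rw [h2, h2] at h1
    exact h1
  have hlt : ∀ i k : Fin n, i < k → Commute (φ (chainGen f i)) (φ (chainGen f k)) := by
    intro i k hik
    rcases (show (i : ℕ) + 1 ≤ k from hik).eq_or_lt with h1 | h1
    · exact hadj i k h1
    · have : Commute (chainGen f i) (chainGen f k) :=
        Subtype.ext (hf.toIsPrechain.commute_of_lt h1)
      exact this.map φ
  refine commute_of_generators φ ?_ x y
  rintro _ ⟨i, rfl⟩ _ ⟨k, rfl⟩
  rcases lt_trichotomy i k with h1 | rfl | h1
  · exact hlt i k h1
  · exact Commute.refl _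
  · exact (hlt k i h1).symm

/-! ### Germs at the ends of the support -/

theorem germ_mul {l : Filter ℝ} {c : ℝ ≃ₜ ℝ} (hc : ∀ k : ℤ, Filter.Tendsto (c ^ k : ℝ ≃ₜ ℝ) l l)
    {g h : ℝ ≃ₜ ℝ} {j k : ℤ} (hg : ∀ᶠ t in l, g t = (c ^ j) t) (hh : ∀ᶠ t in l, h t = (c ^ k) t) :
    ∀ᶠ t in l, (g * h) t = (c ^ (j + k)) t := by
  filter_upwards [hh, (hc k).eventually hg] with t h1 h2
  rw [Homeomorph.mul_apply, h1, h2, zpow_add, Homeomorph.mul_apply]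

theorem germ_inv {l : Filter ℝ} {c : ℝ ≃ₜ ℝ} (hc : ∀ k : ℤ, Filter.Tendsto (c ^ k : ℝ ≃ₜ ℝ) l l)
    {g : ℝ ≃ₜ ℝ} {j : ℤ} (hg : ∀ᶠ t in l, g t = (c ^ j) t) :
    ∀ᶠ t in l, g⁻¹ t = (c ^ (-j)) t := by
  filter_upwards [(hc (-j)).eventually hg] with t h1
  apply g.injective
  rw [homeo_apply_inv_self, h1, ← Homeomorph.mul_apply, ← zpow_add, add_neg_cancel, zpow_zero]
  rfl

/-- Along l the germ of every element of the group is a power of the germ of c, and in a commutator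
the exponents cancel. -/
theorem commutator_germ_trivial {S : Set (ℝ ≃ₜ ℝ)} {l : Filter ℝ} {c : ℝ ≃ₜ ℝ}
    (hc : ∀ k : ℤ, Filter.Tendsto (c ^ k : ℝ ≃ₜ ℝ) l l)
    (hS : ∀ s ∈ S, s = c ∨ ∀ᶠ t in l, s t = t) {g : Subgroup.closure S}
    (hg : g ∈ commutator (Subgroup.closure S)) : ∀ᶠ t in l, (g : ℝ ≃ₜ ℝ) t = t := by
  have key : ∀ g ∈ Subgroup.closure S, ∃ k : ℤ, ∀ᶠ t in l, g t = (c ^ k) t := by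
    intro g hg
    refine Subgroup.closure_induction (p := fun g _ => ∃ k : ℤ, ∀ᶠ t in l, g t = (c ^ k) t)
      ?_ ?_ ?_ ?_ hg
    · intro s hs
      rcases hS s hs with rfl | h
      · exact ⟨1, by simp⟩
      · exact ⟨0, by simpa using h⟩
    · exact ⟨0, by simp⟩
    · rintro a b _ _ ⟨j, hj⟩ ⟨k, hk⟩
      exact ⟨j + k, germ_mul hc hj hk⟩
    · rintro a _ ⟨j, hj⟩
      exact ⟨-j, germ_inv hc hj⟩
  have h0 : ∀ᶠ t in l, (g : ℝ ≃ₜ ℝ) t = (c ^ (0 : ℤ)) t := by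
    rw [commutator_eq_closure] at hg
    refine Subgroup.closure_induction
      (p := fun (g : Subgroup.closure S) _ => ∀ᶠ t in l, (g : ℝ ≃ₜ ℝ) t = (c ^ (0 : ℤ)) t)
      ?_ ?_ ?_ ?_ hg
    · rintro _ ⟨a, b, rfl⟩
      obtain ⟨j, hj⟩ := key a a.2
      obtain ⟨k, hk⟩ := key b b.2
      have := germ_mul hc (germ_mul hc (germ_mul hc hj hk) (germ_inv hc hj)) (germ_inv hc hk)
      rw [show j + k + -j + -k = 0 by ring] at this
      exact this
    · simp
    · intro a b _ _ ha hb
      exact germ_mul hc ha hb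
    · intro a _ ha
      exact germ_inv hc ha
  simpa using h0

/-- This filter describes the left end of the support uniformly, whether it is finite or -∞. It is
preserved because G permutes the points of its support monotonically. -/
theorem IsPrechain.tendsto_left (hf : IsPrechain f) {g : ℝ ≃ₜ ℝ} (hg : g ∈ chainGroup f) :
    Filter.Tendsto g (⨅ x ∈ groupSupport (chainGroup f), Filter.principal (Iio x))
      (⨅ x ∈ groupSupport (chainGroup f), Filter.principal (Iio x)) := by
  simp only [Filter.tendsto_iInf, Filter.tendsto_principal]
  intro x hx
  refine Filter.mem_iInf_of_mem (g⁻¹ x) (Filter.mem_iInf_of_mem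
    (apply_mem_groupSupport (inv_mem hg) hx) (Filter.mem_principal.2 fun t ht => ?_))
  have := HomeoPlus.strictMono (hf.chainGroup_le hg) ht
  rwa [homeo_apply_inv_self] at this

theorem IsPrechain.tendsto_right (hf : IsPrechain f) {g : ℝ ≃ₜ ℝ} (hg : g ∈ chainGroup f) :
    Filter.Tendsto g (⨅ x ∈ groupSupport (chainGroup f), Filter.principal (Ioi x))
      (⨅ x ∈ groupSupport (chainGroup f), Filter.principal (Ioi x)) := by
  simp only [Filter.tendsto_iInf, Filter.tendsto_principal]
  intro x hx
  refine Filter.mem_iInf_of_mem (g⁻¹ x) (Filter.mem_iInf_of_mem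
    (apply_mem_groupSupport (inv_mem hg) hx) (Filter.mem_principal.2 fun t ht => ?_))
  have := HomeoPlus.strictMono (hf.chainGroup_le hg) ht
  rwa [homeo_apply_inv_self] at this

/-- Elements of the commutator subgroup of a prechain group have compact support. -/
theorem IsPrechain.commutator_support (hf : IsPrechain f) (hn : 2 ≤ n) {g : chainGroup f}
    (hg : g ∈ commutator (chainGroup f)) : ∃ x ∈ groupSupport (chainGroup f),
      ∃ y ∈ groupSupport (chainGroup f), ∀ t, t < x ∨ y < t → (g : ℝ ≃ₜ ℝ) t = t := by
  have hne : (groupSupport (chainGroup f)).Nonempty := by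
    obtain ⟨x, hx⟩ := hf.supports.nonempty ⟨0, by omega⟩
    exact ⟨x, mem_groupSupport_of_mem hx⟩
  have hl := commutator_germ_trivial (fun k => hf.tendsto_left
    (zpow_mem (generator_mem f ⟨0, by omega⟩) k)) (S := range f) (by
      rintro _ ⟨⟨i, hi⟩, rfl⟩
      cases i with
      | zero => exact Or.inl rfl
      | succ i =>
        right
        obtain ⟨x, hx, hlt⟩ := hf.exists_lt_support (i := ⟨i, by omega⟩) (k := ⟨i + 1, hi⟩) rfl
        refine Filter.mem_iInf_of_mem x (Filter.mem_iInf_of_mem (mem_groupSupport_of_mem hx)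
          (Filter.mem_principal.2 fun t ht => ?_))
        by_contra h
        exact lt_asymm ht (hlt t h)) hg
  have hr := commutator_germ_trivial (fun k => hf.tendsto_right
    (zpow_mem (generator_mem f ⟨n - 1, by omega⟩) k)) (S := range f) (by
      rintro _ ⟨⟨i, hi⟩, rfl⟩
      rcases (show i + 1 ≤ n from hi).eq_or_lt with h | h
      · left
        congr 1
        exact Fin.ext (by simp only; omega)
      · right
        obtain ⟨x, hx, hlt⟩ := hf.exists_gt_support (i := ⟨i, hi⟩) (k := ⟨i + 1, h⟩) rfl
        refine Filter.mem_iInf_of_mem x (Filter.mem_iInf_of_mem (mem_groupSupport_of_mem hx)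
          (Filter.mem_principal.2 fun t ht => ?_))
        by_contra h
        exact lt_asymm ht (hlt t h)) hg
  rw [Filter.Eventually, Filter.mem_biInf_of_directed _ hne] at hl hr
  · obtain ⟨x, hx, hxs⟩ := hl
    obtain ⟨y, hy, hys⟩ := hr
    refine ⟨x, hx, y, hy, fun t ht => ht.elim (fun h => ?_) (fun h => ?_)⟩
    · exact Filter.mem_principal.1 hxs h
    · exact Filter.mem_principal.1 hys h
  · intro a ha b hb
    rcases le_total a b with h | h
    · exact ⟨b, hb, Filter.principal_mono.2 (Ioi_subset_Ioi h), le_rfl⟩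
    · exact ⟨a, ha, le_rfl, Filter.principal_mono.2 (Ioi_subset_Ioi h)⟩
  · intro a ha b hb
    rcases le_total a b with h | h
    · exact ⟨a, ha, le_rfl, Filter.principal_mono.2 (Iio_subset_Iio h)⟩
    · exact ⟨b, hb, Filter.principal_mono.2 (Iio_subset_Iio h), le_rfl⟩

/-! ### Unbounded orbits, and agreement with G' on compact sets -/

theorem IsPrechain.exists_apply_lt (hf : IsPrechain f) {x y : ℝ}
    (hx : x ∈ groupSupport (chainGroup f)) (hy : y ∈ groupSupport (chainGroup f)) :
    ∃ g ∈ chainGroup f, g y < x := by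
  obtain ⟨i, hi⟩ := mem_groupSupport_chainGroup.1 hx
  have hl : ((⟨0, i.pos⟩ : Fin n) : ℕ) = 0 := rfl
  obtain ⟨z, hz, hzx⟩ := hf.exists_lt_first hl hx
  obtain ⟨g, hg, hgy⟩ := hf.exists_apply_mem hy ⟨0, i.pos⟩
  obtain ⟨m, hm⟩ := hf.exists_inv_pow_lt hgy hz
  exact ⟨(f _ ^ m)⁻¹ * g, mul_mem (inv_mem (pow_mem (generator_mem f _) m)) hg, hm.trans hzx⟩

theorem IsPrechain.exists_lt_apply (hf : IsPrechain f) {x y : ℝ}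
    (hx : x ∈ groupSupport (chainGroup f)) (hy : y ∈ groupSupport (chainGroup f)) :
    ∃ g ∈ chainGroup f, y < g x := by
  obtain ⟨g, hg, hlt⟩ := hf.exists_apply_lt hx hy
  refine ⟨g⁻¹, inv_mem hg, ?_⟩
  have := HomeoPlus.strictMono (hf.chainGroup_le (inv_mem hg)) hlt
  rwa [homeo_inv_apply_self] at this

/-- On a compact set, every element of a prechain group coincides with an element of the commutator
subgroup. -/
theorem IsPrechain.exists_commutator_eqOn (hf : IsPrechain f) (hn : 2 ≤ n) {g : ℝ ≃ₜ ℝ}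
    (hg : g ∈ chainGroup f) : ∀ x ∈ groupSupport (chainGroup f),
      ∀ y ∈ groupSupport (chainGroup f), ∃ g' ∈ (commutator (chainGroup f)).map
        (chainGroup f).subtype, ∀ t ∈ Icc x y, g' t = g t := by
  have hcomm : ∀ {a b : ℝ ≃ₜ ℝ}, a ∈ chainGroup f → b ∈ chainGroup f →
      a * b * a⁻¹ * b⁻¹ ∈ (commutator (chainGroup f)).map (chainGroup f).subtype := by
    intro a b ha hb
    exact ⟨⁅⟨a, ha⟩, ⟨b, hb⟩⁆, Subgroup.commutator_mem_commutator (Subgroup.mem_top _)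
      (Subgroup.mem_top _), rfl⟩
  have hfix : ∀ (a b : ℝ ≃ₜ ℝ) (t : ℝ), a (b⁻¹ t) = b⁻¹ t → (a * b * a⁻¹ * b⁻¹) t = a t := by
    intro a b t h
    rw [Homeomorph.mul_apply, Homeomorph.mul_apply, Homeomorph.mul_apply,
      inv_apply_eq_of_apply_eq h, homeo_apply_inv_self]
  refine Subgroup.closure_induction (p := fun g _ => ∀ x ∈ groupSupport (chainGroup f),
      ∀ y ∈ groupSupport (chainGroup f), ∃ g' ∈ (commutator (chainGroup f)).map
        (chainGroup f).subtype, ∀ t ∈ Icc x y, g' t = g t) ?_ ?_ ?_ ?_ hg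
  · rintro _ ⟨i, rfl⟩ x hx y hy
    by_cases hi : (i : ℕ) + 1 < n
    · obtain ⟨b, hb, hlt⟩ := hf.exists_gt_support (i := i) (k := ⟨i + 1, hi⟩) rfl
      -- The element r moves J_i entirely below x, so r (f i)⁻¹ r⁻¹ is trivial on [x, y] and [f i,
      -- r] agrees there with f i.
      obtain ⟨r, hr, hrx⟩ := hf.exists_apply_lt hx (mem_groupSupport_of_mem hb)
      refine ⟨_, hcomm (generator_mem f i) hr, fun t ht => hfix _ _ _ ?_⟩
      by_contra hne
      have h1 := HomeoPlus.strictMono (hf.chainGroup_le hr) (hlt _ hne)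
      rw [homeo_apply_inv_self] at h1
      exact absurd ht.1 (not_le.2 (h1.trans hrx))
    -- For the last generator, which has a predecessor because n ≥ 2, r moves J_i above y instead.
    · have hi' : (i : ℕ) - 1 + 1 = i := by omega
      obtain ⟨b, hb, hlt⟩ := hf.exists_lt_support (i := ⟨i - 1, by omega⟩) (k := i) hi'
      obtain ⟨r, hr, hrx⟩ := hf.exists_lt_apply (mem_groupSupport_of_mem hb) hy
      refine ⟨_, hcomm (generator_mem f i) hr, fun t ht => hfix _ _ _ ?_⟩
      by_contra hne
      have h1 := HomeoPlus.strictMono (hf.chainGroup_le hr) (hlt _ hne)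
      rw [homeo_apply_inv_self] at h1
      exact absurd ht.2 (not_le.2 (hrx.trans h1))
  · exact fun x _ y _ => ⟨1, one_mem _, fun t _ => rfl⟩
  · intro a b ha hb iha ihb x hx y hy
    obtain ⟨b', hb', hbe⟩ := ihb x hx y hy
    obtain ⟨a', ha', hae⟩ := iha (b x) (apply_mem_groupSupport hb hx) (b y)
      (apply_mem_groupSupport hb hy)
    refine ⟨a' * b', mul_mem ha' hb', fun t ht => ?_⟩
    have hm := (HomeoPlus.strictMono (hf.chainGroup_le hb)).monotone
    rw [Homeomorph.mul_apply, Homeomorph.mul_apply, hbe t ht, hae _ ⟨hm ht.1, hm ht.2⟩]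
  · intro a ha iha x hx y hy
    obtain ⟨a', ha', hae⟩ := iha (a⁻¹ x) (apply_mem_groupSupport (inv_mem ha) hx) (a⁻¹ y)
      (apply_mem_groupSupport (inv_mem ha) hy)
    refine ⟨a'⁻¹, inv_mem ha', fun t ht => ?_⟩
    have hm := (HomeoPlus.strictMono (hf.chainGroup_le (inv_mem ha))).monotone
    apply a'.injective
    rw [homeo_apply_inv_self, hae _ ⟨hm ht.1, hm ht.2⟩, homeo_apply_inv_self]

/-! ### Minimal chain groups -/

theorem IsPrechain.compresses (hf : IsPrechain f) (hn : 2 ≤ n)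
    (hmin : ActsMinimally (chainGroup f)) :
    Compresses (chainGroup f) (groupSupport (chainGroup f)) := by
  obtain ⟨p, hp, hcon⟩ := hf.exists_contracting_point hn
  refine compresses_of_point hf.chainGroup_le hcon fun u hu v hv huv => ?_
  obtain ⟨w, huw, hwv⟩ := exists_between huv
  have hw : w ∈ closure (groupOrbit (chainGroup f) p) :=
    hmin p hp (hf.ordConnected_support.out hu hv ⟨huw.le, hwv.le⟩)
  obtain ⟨_, ht, k, hk, rfl⟩ := mem_closure_iff.1 hw (Ioo u v) isOpen_Ioo ⟨huw, hwv⟩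
  exact ⟨k, hk, ht.1, ht.2⟩

theorem IsPrechain.compresses_commutator (hf : IsPrechain f) (hn : 2 ≤ n)
    (hmin : ActsMinimally (chainGroup f)) :
    Compresses ((commutator (chainGroup f)).map (chainGroup f).subtype)
      (groupSupport (chainGroup f)) := by
  intro x hx y hy hxy u hu v hv huv
  obtain ⟨k, hk, hux, hyv⟩ := hf.compresses hn hmin x hx y hy hxy u hu v hv huv
  obtain ⟨k', hk', heq⟩ := hf.exists_commutator_eqOn hn hk x hx y hy
  refine ⟨k', hk', ?_, ?_⟩
  · rwa [heq x ⟨le_rfl, hxy⟩]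
  · rwa [heq y ⟨hxy, le_rfl⟩]

/-- In a minimal chain group, a nontrivial subgroup normalised by a compressing subgroup `K` that
contains `G'` also contains `G''`. -/
theorem IsPrechain.commutator_mem (hf : IsPrechain f) (hn : 2 ≤ n)
    {K N : Subgroup (chainGroup f)} (hCK : commutator (chainGroup f) ≤ K)
    (hK : Compresses (K.map (chainGroup f).subtype) (groupSupport (chainGroup f)))
    (hN : N ≠ ⊥) (hnorm : ∀ k ∈ K, ∀ g ∈ N, k * g * k⁻¹ ∈ N) {u v : chainGroup f}
    (hu : u ∈ commutator (chainGroup f)) (hv : v ∈ commutator (chainGroup f)) :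
    ⁅u, v⁆ ∈ N := by
  rw [ne_eq, Subgroup.eq_bot_iff_forall] at hN
  push Not at hN
  obtain ⟨g, hg, hg1⟩ := hN
  obtain ⟨z, hz⟩ : ∃ z, (g : ℝ ≃ₜ ℝ) z ≠ z := by
    by_contra! hc
    exact hg1 (Subtype.ext (Homeomorph.ext hc))
  have hle : ∀ L : Subgroup (chainGroup f), L.map (chainGroup f).subtype ≤ HomeoPlus := by
    rintro L _ ⟨g, _, rfl⟩
    exact hf.chainGroup_le g.2
  have hzI : z ∈ groupSupport (chainGroup f) := mem_groupSupport.2 ⟨g, g.2, hz⟩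
  obtain ⟨x₁, hx₁, y₁, hy₁, h₁⟩ := hf.commutator_support hn hu
  obtain ⟨x₂, hx₂, y₂, hy₂, h₂⟩ := hf.commutator_support hn hv
  have hmin : min x₁ x₂ ∈ groupSupport (chainGroup f) := by
    rcases min_choice x₁ x₂ with h | h <;> rw [h] <;> assumption
  have hmax : max y₁ y₂ ∈ groupSupport (chainGroup f) := by
    rcases max_choice y₁ y₂ with h | h <;> rw [h] <;> assumption
  obtain ⟨w, hw, hwe⟩ := commutator_mem_of_compresses (hle K) (hle N) hK (by
      rintro _ ⟨k, hk, rfl⟩ _ ⟨g, hg, rfl⟩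
      exact ⟨k * g * k⁻¹, hnorm k hk g hg, rfl⟩) (Subgroup.mem_map_of_mem _ hg) hzI
    (apply_mem_groupSupport g.2 hzI) hz (Subgroup.mem_map_of_mem _ (hCK hu))
    (Subgroup.mem_map_of_mem _ (hCK hv)) hmin hmax
    (fun t ht => h₁ t (ht.imp (fun h => h.trans_le (min_le_left _ _))
      (fun h => (le_max_left _ _).trans_lt h)))
    (fun t ht => h₂ t (ht.imp (fun h => h.trans_le (min_le_right _ _))
      (fun h => (le_max_right _ _).trans_lt h)))
  have : w = ⁅u, v⁆ := Subtype.ext hwe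
  rwa [this] at hw

/-- A nontrivial normal N contains G'', so G' has commutative image in G/N, and perfectness of G' in
the form `IsChainFamily.hom_commute` concludes. -/
theorem IsChainFamily.quotient_commute (hf : IsChainFamily f) (hn : 2 ≤ n)
    (hmin : ActsMinimally (chainGroup f)) (N : Subgroup (chainGroup f)) [hNn : N.Normal]
    (hN : N ≠ ⊥) (a b : chainGroup f ⧸ N) : a * b = b * a := by
  obtain ⟨a, rfl⟩ := QuotientGroup.mk'_surjective N a
  obtain ⟨b, rfl⟩ := QuotientGroup.mk'_surjective N b
  refine hf.hom_commute (QuotientGroup.mk' N) (fun u hu v hv => ?_) a b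
  have hG : (⊤ : Subgroup (chainGroup f)).map (chainGroup f).subtype = chainGroup f := by
    rw [← MonoidHom.range_eq_map, Subgroup.range_subtype]
  have := hf.toIsPrechain.commutator_mem hn (K := ⊤) le_top
    (by rw [hG]; exact hf.toIsPrechain.compresses hn hmin) hN
    (fun k _ g hg => hNn.conj_mem g hg k) hu hv
  rw [← commutatorElement_eq_one_iff_commute, ← map_commutatorElement]
  exact (QuotientGroup.eq_one_iff _).2 this

theorem IsChainFamily.isSimpleGroup_commutator (hf : IsChainFamily f) (hn : 2 ≤ n)
    (hmin : ActsMinimally (chainGroup f)) : IsSimpleGroup (commutator (chainGroup f)) := by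
  set C := commutator (chainGroup f) with hC
  -- The image of C in G/[C, C] is commutative, so G/[C, C] is abelian and [C, C] contains G' = C.
  have hperf : C ≤ ⁅C, C⁆ := by
    rw [hC, commutator_def, Subgroup.commutator_le]
    intro x _ y _
    have := hf.hom_commute (QuotientGroup.mk' ⁅C, C⁆) (fun u hu v hv => by
      rw [← commutatorElement_eq_one_iff_commute, ← map_commutatorElement]
      exact (QuotientGroup.eq_one_iff _).2 (Subgroup.commutator_mem_commutator hu hv)) x y
    rw [← commutatorElement_eq_one_iff_commute, ← map_commutatorElement] at this
    exact (QuotientGroup.eq_one_iff _).1 this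
  have hnt : Nontrivial C := by
    refine ⟨⟨⁅chainGen f ⟨0, by omega⟩, chainGen f ⟨1, by omega⟩⁆,
      Subgroup.commutator_mem_commutator (Subgroup.mem_top _) (Subgroup.mem_top _)⟩, 1, fun h => ?_⟩
    have h1 := commutatorElement_eq_one_iff_commute.1 (congrArg Subtype.val h)
    exact hf.toIsPrechain.not_commute rfl (h1.map (chainGroup f).subtype)
  refine ⟨fun N hNn => or_iff_not_imp_left.2 fun hN => ?_⟩
  have hN' : N.map C.subtype ≠ ⊥ := by
    rwa [ne_eq, Subgroup.map_eq_bot_iff_of_injective _ C.subtype_injective]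
  have hle : ⁅C, C⁆ ≤ N.map C.subtype := by
    rw [Subgroup.commutator_le]
    intro u hu v hv
    refine hf.toIsPrechain.commutator_mem hn (K := C) le_rfl
      (hf.toIsPrechain.compresses_commutator hn hmin) hN' ?_ hu hv
    rintro k hk _ ⟨g, hg, rfl⟩
    exact ⟨⟨k, hk⟩ * g * ⟨k, hk⟩⁻¹, hNn.conj_mem g hg ⟨k, hk⟩, rfl⟩
  rw [Subgroup.eq_top_iff']
  rintro ⟨g, hg⟩
  obtain ⟨w, hw, hwe⟩ := hle (hperf hg)
  have : w = ⟨g, hg⟩ := Subtype.ext hwe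
  rwa [← this]

end Chain

/-! ### Staircase maps -/

/-- Collapsing the complementary intervals of a perfect subset of an interval, which is unbounded
in both directions, to points. -/
theorem exists_staircase {I Λ : Set ℝ} (hI : I.OrdConnected) (hne : I.Nonempty) (hΛI : Λ ⊆ I)
    (hperf : Preperfect Λ) (hup : ∀ x ∈ I, ∃ l ∈ Λ, x < l) (hdown : ∀ x ∈ I, ∃ l ∈ Λ, l < x) :
    ∃ h : ℝ → ℝ, ContinuousOn h I ∧ MonotoneOn h I ∧ h '' I = univ ∧
      ∀ x ∈ I, ∀ y ∈ I, h x = h y ↔ uIoo x y ∩ Λ = ∅ := by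
  -- The relation `sep x y` is to become h x < h y. As Λ has no isolated points, a separating point
  -- of Λ is accompanied by a second one, and a rational between the two shows that the order of
  -- classes is dense.
  set sep : ℝ → ℝ → Prop := fun x y => ∃ l ∈ Λ, x < l ∧ l < y with hsep
  have two : ∀ {x y}, sep x y → ∃ l ∈ Λ, ∃ l' ∈ Λ, x < l ∧ l < l' ∧ l' < y := by
    rintro x y ⟨l, hl, hxl, hly⟩
    obtain ⟨l', ⟨hl'U, hl'⟩, hne⟩ := accPt_iff_nhds.1 (hperf l hl) (Ioo x y)
      (Ioo_mem_nhds hxl hly)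
    rcases lt_or_gt_of_ne hne with h | h
    · exact ⟨l', hl', l, hl, hl'U.1, h, hly⟩
    · exact ⟨l, hl, l', hl', hxl, h, hl'U.2⟩
  have between : ∀ {x y}, sep x y → ∃ q : ℚ, (q : ℝ) ∈ I ∧ sep x q ∧ sep q y := by
    intro x y hxy
    obtain ⟨l, hl, l', hl', h1, h2, h3⟩ := two hxy
    obtain ⟨q, hq, hq'⟩ := exists_rat_btwn h2
    exact ⟨q, hI.out (hΛI hl) (hΛI hl') ⟨hq.le, hq'.le⟩, ⟨l, hl, h1, hq⟩, ⟨l', hl', hq', h3⟩⟩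
  have above : ∀ x ∈ I, ∃ q : ℚ, (q : ℝ) ∈ I ∧ sep x q := by
    intro x hx
    obtain ⟨l, hl, hxl⟩ := hup x hx
    obtain ⟨l', hl', hll⟩ := hup l (hΛI hl)
    obtain ⟨q, hq, h, -⟩ := between ⟨l, hl, hxl, hll⟩
    exact ⟨q, hq, h⟩
  have below : ∀ x ∈ I, ∃ q : ℚ, (q : ℝ) ∈ I ∧ sep q x := by
    intro x hx
    obtain ⟨l, hl, hxl⟩ := hdown x hx
    obtain ⟨l', hl', hll⟩ := hdown l (hΛI hl)
    obtain ⟨q, hq, -, h⟩ := between ⟨l, hl, hll, hxl⟩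
    exact ⟨q, hq, h⟩
  -- the right endpoint of the collapsed interval of `x`
  set ρ : ℝ → ℝ := fun x => sSup {y ∈ I | ¬ sep x y} with hρ
  have hself : ∀ x ∈ I, x ∈ {y ∈ I | ¬ sep x y} :=
    fun x hx => ⟨hx, fun ⟨l, _, h, h'⟩ => lt_asymm h h'⟩
  have hbd : ∀ x, ∀ l ∈ Λ, x < l → ∀ y ∈ {y ∈ I | ¬ sep x y}, y ≤ l :=
    fun x l hl hxl y hy => not_lt.1 fun h => hy.2 ⟨l, hl, hxl, h⟩
  have r1 : ∀ x ∈ I, ∀ l ∈ Λ, x < l → ρ x ≤ l := fun x hx l hl hxl =>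
    csSup_le ⟨x, hself x hx⟩ (hbd x l hl hxl)
  have hbdd : ∀ x ∈ I, BddAbove {y ∈ I | ¬ sep x y} := by
    intro x hx
    obtain ⟨l, hl, hxl⟩ := hup x hx
    exact ⟨l, hbd x l hl hxl⟩
  have r2 : ∀ x ∈ I, x ≤ ρ x := fun x hx => le_csSup (hbdd x hx) (hself x hx)
  have r3 : ∀ x ∈ I, ∀ y ∈ I, sep x y → ρ x < ρ y := by
    intro x hx y hy hxy
    obtain ⟨l, hl, l', hl', h1, h2, h3⟩ := two hxy
    exact (r1 x hx l hl h1).trans_lt ((h2.trans h3).trans_le (r2 y hy))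
  have r4 : ∀ x ∈ I, ∀ y ∈ I, ρ x < ρ y → sep x y := by
    intro x hx y hy hlt
    by_contra hn
    refine not_le.2 hlt (csSup_le ⟨y, hself y hy⟩ fun w hw => le_csSup (hbdd x hx) ⟨hw.1, ?_⟩)
    intro hxw
    obtain ⟨l, hl, l', hl', h1, h2, h3⟩ := two hxw
    rcases lt_or_ge y l' with h | h
    · exact hw.2 ⟨l', hl', h, h3⟩
    · exact hn ⟨l, hl, h1, h2.trans_le h⟩
  -- The classes of rational points, represented by their values under ρ, form a countable dense
  -- order without endpoints, hence are isomorphic to ℚ by Cantor's theorem.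
  set D : Set ℝ := (fun q : ℚ => ρ q) '' {q : ℚ | (q : ℝ) ∈ I} with hD
  have hmemD : ∀ q : ℚ, (q : ℝ) ∈ I → ρ q ∈ D := fun q hq => ⟨q, hq, rfl⟩
  have : Countable D := ((to_countable {q : ℚ | (q : ℝ) ∈ I}).image _).to_subtype
  have : Nonempty D := by
    obtain ⟨x, hx⟩ := hne
    obtain ⟨q, hq, -⟩ := above x hx
    exact ⟨⟨ρ q, hmemD q hq⟩⟩
  have : DenselyOrdered D := by
    refine ⟨?_⟩
    rintro ⟨_, a, ha, rfl⟩ ⟨_, b, hb, rfl⟩ hab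
    obtain ⟨q, hq, h1, h2⟩ := between (r4 _ ha _ hb hab)
    exact ⟨⟨ρ q, hmemD q hq⟩, r3 _ ha _ hq h1, r3 _ hq _ hb h2⟩
  have : NoMinOrder D := by
    refine ⟨?_⟩
    rintro ⟨_, a, ha, rfl⟩
    obtain ⟨q, hq, h⟩ := below _ ha
    exact ⟨⟨ρ q, hmemD q hq⟩, r3 _ hq _ ha h⟩
  have : NoMaxOrder D := by
    refine ⟨?_⟩
    rintro ⟨_, a, ha, rfl⟩
    obtain ⟨q, hq, h⟩ := above _ ha
    exact ⟨⟨ρ q, hmemD q hq⟩, r3 _ ha _ hq h⟩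
  obtain ⟨e⟩ := Order.iso_of_countable_dense D ℚ
  -- The isomorphism D ≃ ℚ is extended to all classes by Dedekind cuts; `below` and `above` make
  -- each set nonempty and bounded, so `sSup` is a genuine supremum.
  set h : ℝ → ℝ := fun x => sSup {r : ℝ | ∃ d : D, (d : ℝ) ≤ ρ x ∧ ((e d : ℚ) : ℝ) = r} with hh
  have hle : ∀ {x : ℝ} {q : ℚ} (hq : (q : ℝ) ∈ I), ρ x ≤ ρ q →
      ∀ r ∈ {r : ℝ | ∃ d : D, (d : ℝ) ≤ ρ x ∧ ((e d : ℚ) : ℝ) = r},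
        r ≤ (e ⟨ρ q, hmemD q hq⟩ : ℚ) := by
    rintro x q hq hxq _ ⟨d, hd, rfl⟩
    exact Rat.cast_le.2 (e.monotone (hd.trans hxq))
  have h1 : ∀ {x : ℝ} {q : ℚ} (_ : x ∈ I) (hq : (q : ℝ) ∈ I), ρ x ≤ ρ q →
      h x ≤ (e ⟨ρ q, hmemD q hq⟩ : ℚ) := by
    intro x q hx hq hxq
    refine csSup_le ?_ (hle hq hxq)
    obtain ⟨q', hq', hs⟩ := below x hx
    exact ⟨_, ⟨ρ q', hmemD q' hq'⟩, (r3 _ hq' _ hx hs).le, rfl⟩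
  have h2 : ∀ {x : ℝ} {q : ℚ} (_ : x ∈ I) (hq : (q : ℝ) ∈ I), ρ q ≤ ρ x →
      (e ⟨ρ q, hmemD q hq⟩ : ℚ) ≤ h x := by
    intro x q hx hq hxq
    obtain ⟨q', hq', hs⟩ := above x hx
    exact le_csSup ⟨_, hle hq' (r3 _ hx _ hq' hs).le⟩ ⟨⟨ρ q, hmemD q hq⟩, hxq, rfl⟩
  have hval : ∀ r : ℚ, ∃ q : ℚ, ∃ hq : (q : ℝ) ∈ I, e ⟨ρ q, hmemD q hq⟩ = r := by
    intro r
    obtain ⟨⟨_, q, hq, rfl⟩, hr⟩ := e.surjective r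
    exact ⟨q, hq, hr⟩
  have hlt : ∀ x ∈ I, ∀ y ∈ I, (h x < h y ↔ sep x y) := by
    intro x hx y hy
    constructor
    · intro hxy
      by_contra hn
      have hρ' : ρ y ≤ ρ x := not_lt.1 fun hc => hn (r4 x hx y hy hc)
      obtain ⟨r, hr, hr'⟩ := exists_rat_btwn hxy
      obtain ⟨q, hq, rfl⟩ := hval r
      have hxq : ρ x < ρ q := not_le.1 fun hc => absurd (h2 hx hq hc) (not_le.2 hr)
      exact absurd (h1 hy hq (hρ'.trans hxq.le)) (not_le.2 hr')
    · intro hxy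
      obtain ⟨a, ha, hxa, hay⟩ := between hxy
      obtain ⟨b, hb, hab, hby⟩ := between hay
      refine (h1 hx ha (r3 _ hx _ ha hxa).le).trans_lt (lt_of_lt_of_le ?_
        (h2 hy hb (r3 _ hb _ hy hby).le))
      exact Rat.cast_lt.2 (e.strictMono (r3 _ ha _ hb hab))
  have hmono : MonotoneOn h I := by
    intro x hx y hy hxy
    by_contra! hc
    obtain ⟨l, _, hl1, hl2⟩ := (hlt y hy x hx).1 hc
    exact absurd (hl1.trans hl2) (not_lt.2 hxy)
  have hrat : ∀ r : ℚ, ∃ x ∈ I, h x = r := by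
    intro r
    obtain ⟨q, hq, rfl⟩ := hval r
    exact ⟨q, hq, le_antisymm (h1 hq hq le_rfl) (h2 hq hq le_rfl)⟩
  have hsurj : ∀ t : ℝ, ∃ x ∈ I, h x = t := by
    intro t
    obtain ⟨r, hr⟩ := exists_rat_lt t
    obtain ⟨r', hr'⟩ := exists_rat_gt t
    obtain ⟨a, ha, har⟩ := hrat r
    obtain ⟨b, hb, hbr⟩ := hrat r'
    have haA : a ∈ {x ∈ I | h x ≤ t} := ⟨ha, by rw [har]; exact hr.le⟩
    have hbA : ∀ c ∈ I, t < h c → ∀ x ∈ {x ∈ I | h x ≤ t}, x ≤ c := by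
      intro c hc htc x hx
      by_contra! hcx
      exact absurd (hmono hc hx.1 hcx.le) (not_le.2 (hx.2.trans_lt htc))
    have hbA' := hbA b hb (by rw [hbr]; exact hr')
    set s := sSup {x ∈ I | h x ≤ t} with hs
    have hsI : s ∈ I := hI.out ha hb ⟨le_csSup ⟨b, hbA'⟩ haA, csSup_le ⟨a, haA⟩ hbA'⟩
    refine ⟨s, hsI, le_antisymm (not_lt.1 fun hc => ?_) (not_lt.1 fun hc => ?_)⟩
    · obtain ⟨r, hr, hr'⟩ := exists_rat_btwn hc
      obtain ⟨c, hc, hcr⟩ := hrat r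
      have : s ≤ c := csSup_le ⟨a, haA⟩ (hbA c hc (by rwa [hcr]))
      exact absurd (hmono hsI hc this) (not_le.2 (by rwa [hcr]))
    · obtain ⟨r, hr, hr'⟩ := exists_rat_btwn hc
      obtain ⟨c, hc, hcr⟩ := hrat r
      have : c ≤ s := le_csSup ⟨b, hbA'⟩ ⟨hc, by rw [hcr]; exact hr'.le⟩
      exact absurd (hmono hc hsI this) (not_le.2 (by rwa [hcr]))
  refine ⟨h, ?_, hmono, eq_univ_of_forall fun t => ?_, ?_⟩
  · rw [continuousOn_iff_continuous_domRestrict]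
    apply Monotone.continuous_of_surjective
    · exact fun a b hab => hmono a.2 b.2 hab
    · intro t
      obtain ⟨x, hx, hxt⟩ := hsurj t
      exact ⟨⟨x, hx⟩, hxt⟩
  · obtain ⟨x, hx, hxt⟩ := hsurj t
    exact ⟨x, hx, hxt⟩
  · intro x hx y hy
    rw [eq_empty_iff_forall_notMem]
    constructor
    · rintro heq l ⟨⟨hl1, hl2⟩, hl⟩
      rcases le_total x y with hxy | hxy
      · rw [min_eq_left hxy] at hl1
        rw [max_eq_right hxy] at hl2
        exact absurd heq ((hlt x hx y hy).2 ⟨l, hl, hl1, hl2⟩).ne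
      · rw [min_eq_right hxy] at hl1
        rw [max_eq_left hxy] at hl2
        exact absurd heq ((hlt y hy x hx).2 ⟨l, hl, hl1, hl2⟩).ne'
    · intro hn
      refine le_antisymm (not_lt.1 fun hc => ?_) (not_lt.1 fun hc => ?_)
      · obtain ⟨l, hl, hl1, hl2⟩ := (hlt y hy x hx).1 hc
        exact hn l ⟨⟨(min_le_right _ _).trans_lt hl1, hl2.trans_le (le_max_left _ _)⟩, hl⟩
      · obtain ⟨l, hl, hl1, hl2⟩ := (hlt x hx y hy).1 hc
        exact hn l ⟨⟨(min_le_left _ _).trans_lt hl1, hl2.trans_le (le_max_right _ _)⟩, hl⟩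

theorem lt_iff_of_fibre {I Λ : Set ℝ} {h : ℝ → ℝ} (hmono : MonotoneOn h I)
    (hfib : ∀ x ∈ I, ∀ y ∈ I, h x = h y ↔ uIoo x y ∩ Λ = ∅) {x y : ℝ} (hx : x ∈ I) (hy : y ∈ I) :
    h x < h y ↔ ∃ l ∈ Λ, x < l ∧ l < y := by
  constructor
  · intro hlt
    have hxy : x ≤ y := by
      by_contra! hc
      exact absurd (hmono hy hx hc.le) (not_le.2 hlt)
    obtain ⟨l, ⟨hl1, hl2⟩, hl⟩ := nonempty_iff_ne_empty.2 fun hc => hlt.ne ((hfib x hx y hy).2 hc)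
    rw [min_eq_left hxy] at hl1
    rw [max_eq_right hxy] at hl2
    exact ⟨l, hl, hl1, hl2⟩
  · rintro ⟨l, hl, hl1, hl2⟩
    refine lt_of_le_of_ne (hmono hx hy (hl1.trans hl2).le) fun heq => ?_
    have := (hfib x hx y hy).1 heq
    rw [eq_empty_iff_forall_notMem] at this
    exact this l ⟨⟨(min_le_left _ _).trans_lt hl1, hl2.trans_le (le_max_right _ _)⟩, hl⟩

/-- The action of `G` on `supp G` descends along a staircase map. -/
theorem exists_staircaseSemiconj {G : Subgroup (ℝ ≃ₜ ℝ)} (hG : G ≤ HomeoPlus) {Λ : Set ℝ}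
    (hΛ : ∀ g ∈ G, ∀ x ∈ Λ, g x ∈ Λ) {h : ℝ → ℝ} (hcont : ContinuousOn h (groupSupport G))
    (hmono : MonotoneOn h (groupSupport G)) (himg : h '' groupSupport G = univ)
    (hfib : ∀ x ∈ groupSupport G, ∀ y ∈ groupSupport G, h x = h y ↔ uIoo x y ∩ Λ = ∅) :
    ∃ Φ : G →* (ℝ ≃ₜ ℝ), IsStaircaseSemiconj G Λ h Φ := by
  have hlt : ∀ g ∈ G, ∀ x ∈ groupSupport G, ∀ y ∈ groupSupport G, h x < h y →
      h (g x) < h (g y) := by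
    intro g hg x hx y hy hxy
    obtain ⟨l, hl, hl1, hl2⟩ := (lt_iff_of_fibre hmono hfib hx hy).1 hxy
    have hm := HomeoPlus.strictMono (hG hg)
    exact (lt_iff_of_fibre hmono hfib (apply_mem_groupSupport hg hx)
      (apply_mem_groupSupport hg hy)).2 ⟨g l, hΛ g hg l hl, hm hl1, hm hl2⟩
  have heq : ∀ g ∈ G, ∀ x ∈ groupSupport G, ∀ y ∈ groupSupport G, h x = h y →
      h (g x) = h (g y) := by
    have hle : ∀ g ∈ G, ∀ x ∈ groupSupport G, ∀ y ∈ groupSupport G, h x = h y →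
        h (g x) ≤ h (g y) := by
      intro g hg x hx y hy hxy
      by_contra! hc
      have := hlt g⁻¹ (inv_mem hg) _ (apply_mem_groupSupport hg hy) _
        (apply_mem_groupSupport hg hx) hc
      rw [homeo_inv_apply_self, homeo_inv_apply_self] at this
      exact this.ne' hxy
    exact fun g hg x hx y hy hxy =>
      le_antisymm (hle g hg x hx y hy hxy) (hle g hg y hy x hx hxy.symm)
  have hsec : ∀ t : ℝ, ∃ x ∈ groupSupport G, h x = t := fun t =>
    (eq_univ_iff_forall.1 himg t)
  -- The induced map t ↦ h (g (σ t)) does not depend on the section σ, because g maps fibres of h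
  -- into fibres.
  choose σ hσ hσh using hsec
  set F : G → ℝ → ℝ := fun g t => h ((g : ℝ ≃ₜ ℝ) (σ t)) with hF
  have hsemi : ∀ g : G, ∀ x ∈ groupSupport G, h ((g : ℝ ≃ₜ ℝ) x) = F g (h x) :=
    fun g x hx => heq g g.2 _ hx _ (hσ _) (hσh _).symm
  have hmul : ∀ (g g' : G) (t : ℝ), F (g * g') t = F g (F g' t) := by
    intro g g' t
    rw [← hsemi g _ (apply_mem_groupSupport g'.2 (hσ t))]
    rfl
  have hone : ∀ t, F 1 t = t := fun t => hσh t
  have hF_mono : ∀ g, StrictMono (F g) := fun g a b hab =>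
    hlt g g.2 _ (hσ a) _ (hσ b) (by rwa [hσh, hσh])
  have hF_surj : ∀ g, Function.Surjective (F g) := fun g t =>
    ⟨F g⁻¹ t, by rw [← hmul, mul_inv_cancel, hone]⟩
  refine ⟨MonoidHom.mk' (fun g => ((hF_mono g).orderIsoOfSurjective _ (hF_surj g)).toHomeomorph)
    fun g g' => Homeomorph.ext fun t => hmul g g' t, ?_⟩
  exact ⟨fun g => hF_mono g, hcont, hmono, himg, hsemi, hfib⟩

/-- Two semiconjugacies along staircase maps for the same set are conjugate. -/
theorem IsStaircaseSemiconj.exists_conj {G : Subgroup (ℝ ≃ₜ ℝ)} {Λ : Set ℝ} {h₁ h₂ : ℝ → ℝ}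
    {Φ₁ Φ₂ : G →* (ℝ ≃ₜ ℝ)} (H₁ : IsStaircaseSemiconj G Λ h₁ Φ₁)
    (H₂ : IsStaircaseSemiconj G Λ h₂ Φ₂) :
    ∃ k ∈ HomeoPlus, (∀ x ∈ groupSupport G, h₂ x = k (h₁ x)) ∧
      ∀ g, Φ₂ g = k * Φ₁ g * k⁻¹ := by
  have hsec : ∀ t : ℝ, ∃ x ∈ groupSupport G, h₁ x = t := fun t =>
    (eq_univ_iff_forall.1 H₁.image_eq t)
  choose σ hσ hσh using hsec
  have hk : ∀ x ∈ groupSupport G, h₂ x = h₂ (σ (h₁ x)) := fun x hx =>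
    (H₂.fibre _ hx _ (hσ _)).2 ((H₁.fibre _ hx _ (hσ _)).1 (hσh _).symm)
  have hmono : StrictMono fun t => h₂ (σ t) := by
    intro a b hab
    rw [lt_iff_of_fibre H₂.monotoneOn H₂.fibre (hσ a) (hσ b),
      ← lt_iff_of_fibre H₁.monotoneOn H₁.fibre (hσ a) (hσ b), hσh, hσh]
    exact hab
  have hsurj : Function.Surjective fun t => h₂ (σ t) := by
    intro t
    obtain ⟨x, hx, rfl⟩ := eq_univ_iff_forall.1 H₂.image_eq t
    exact ⟨h₁ x, (hk x hx).symm⟩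
  set k : ℝ ≃ₜ ℝ := (hmono.orderIsoOfSurjective _ hsurj).toHomeomorph
  have hkk : ∀ x ∈ groupSupport G, h₂ x = k (h₁ x) := hk
  refine ⟨k, hmono, hkk, fun g => ?_⟩
  rw [eq_mul_inv_iff_mul_eq]
  ext t
  obtain ⟨x, hx, rfl⟩ := eq_univ_iff_forall.1 H₁.image_eq t
  rw [Homeomorph.mul_apply, Homeomorph.mul_apply, ← hkk x hx, ← H₂.semiconj g x hx,
    ← H₁.semiconj g x hx, hkk _ (apply_mem_groupSupport g.2 hx)]

/-! ### The quotient action along a staircase map -/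

theorem range_eq_closure_image {M Q : Type*} [Group M] [Group Q] {S : Set M}
    (φ : Subgroup.closure S →* Q) :
    φ.range = Subgroup.closure (φ '' (Subtype.val ⁻¹' S)) := by
  rw [MonoidHom.range_eq_map, ← Subgroup.closure_closure_coe_preimage, MonoidHom.map_closure]

theorem pow_apply_eq_of_apply_eq {f : ℝ ≃ₜ ℝ} {x : ℝ} (h : f x = x) (m : ℕ) : (f ^ m) x = x := by
  induction m with
  | zero => rfl
  | succ m ih => rw [pow_succ, Homeomorph.mul_apply, h, ih]

section Chain

variable {n : ℕ} {f : Fin n → (ℝ ≃ₜ ℝ)} {Λ : Set ℝ} {h : ℝ → ℝ}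
  {Φ : chainGroup f →* (ℝ ≃ₜ ℝ)}

theorem IsPrechain.exists_mem_invariant (hf : IsPrechain f)
    (hΛ : IsClosedInvariant (chainGroup f) Λ) (i : Fin n) : ∃ l ∈ Λ, l ∈ homeoSupport (f i) := by
  obtain ⟨l, hl⟩ := hΛ.nonempty
  obtain ⟨g, hg, hgl⟩ := hf.exists_apply_mem (hΛ.subset_support hl) i
  exact ⟨g l, hΛ.invariant g hg l hl, hgl⟩

/-- Were h x fixed by the image of f i for some x ∈ J_i, then h would be constant on the orbit of x
under f i. That orbit has points on both sides of a point of Λ ∩ J_i, which h must separate. -/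
theorem IsStaircaseSemiconj.mem_support_iff (H : IsStaircaseSemiconj (chainGroup f) Λ h Φ)
    (hf : IsPrechain f) (hΛ : IsClosedInvariant (chainGroup f) Λ) (i : Fin n) {x : ℝ}
    (hx : x ∈ groupSupport (chainGroup f)) :
    h x ∈ homeoSupport (Φ (chainGen f i)) ↔ x ∈ homeoSupport (f i) := by
  constructor
  · intro hhx hfix
    apply hhx
    rw [← H.semiconj _ x hx]
    exact congrArg h hfix
  · intro hxi hfix
    obtain ⟨l, hl, hli⟩ := hf.exists_mem_invariant hΛ i
    obtain ⟨m, hm⟩ := hf.exists_pow_gt hxi hli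
    obtain ⟨m', hm'⟩ := hf.exists_inv_pow_lt hxi hli
    have h1 : h ((f i ^ m) x) = h x := by
      have := H.semiconj (chainGen f i ^ m) x hx
      rwa [map_pow, pow_apply_eq_of_apply_eq hfix] at this
    have h2 : h ((f i ^ m')⁻¹ x) = h x := by
      have := H.semiconj (chainGen f i ^ m')⁻¹ x hx
      rwa [map_inv, map_pow, inv_apply_eq_of_apply_eq (pow_apply_eq_of_apply_eq hfix m')] at this
    have h3 := (lt_iff_of_fibre H.monotoneOn H.fibre
      (mem_groupSupport_of_mem (inv_pow_apply_mem_homeoSupport m' hxi))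
      (mem_groupSupport_of_mem (pow_apply_mem_homeoSupport m hxi))).2 ⟨l, hl, hm', hm⟩
    rw [h1, h2] at h3
    exact lt_irrefl _ h3

theorem IsStaircaseSemiconj.isPrechain (H : IsStaircaseSemiconj (chainGroup f) Λ h Φ)
    (hf : IsPrechain f) (hΛ : IsClosedInvariant (chainGroup f) Λ) :
    IsPrechain fun i => Φ (chainGen f i) := by
  have hsurj : ∀ t : ℝ, ∃ x ∈ groupSupport (chainGroup f), h x = t :=
    eq_univ_iff_forall.1 H.image_eq
  have hmem : ∀ i x, x ∈ homeoSupport (f i) → h x ∈ homeoSupport (Φ (chainGen f i)) :=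
    fun i x hx => (H.mem_support_iff hf hΛ i (mem_groupSupport_of_mem hx)).2 hx
  have hss : ∀ i k k' : Fin n, homeoSupport (f i) ∩ homeoSupport (f k) ⊂ homeoSupport (f k') →
      homeoSupport (Φ (chainGen f i)) ∩ homeoSupport (Φ (chainGen f k))
        ⊆ homeoSupport (Φ (chainGen f k')) →
      homeoSupport (Φ (chainGen f i)) ∩ homeoSupport (Φ (chainGen f k))
        ⊂ homeoSupport (Φ (chainGen f k')) := by
    intro i k k' hlt hle
    obtain ⟨x, hx, hxn⟩ := exists_of_ssubset hlt
    refine ssubset_of_subset_not_subset hle fun hc => hxn ?_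
    have hxI := mem_groupSupport_of_mem hx
    have := hc (hmem _ _ hx)
    exact ⟨(H.mem_support_iff hf hΛ i hxI).1 this.1, (H.mem_support_iff hf hΛ k hxI).1 this.2⟩
  refine ⟨fun i => H.mem_homeoPlus _, ⟨fun i => isOpen_homeoSupport _, ?_, ?_, ?_, ?_, ?_, ?_, ?_⟩,
    ?_⟩
  · refine fun i => ⟨fun a ha b hb c hc => ?_⟩
    obtain ⟨x, hx, rfl⟩ := hsurj a
    obtain ⟨y, hy, rfl⟩ := hsurj b
    obtain ⟨z, hz, rfl⟩ := hsurj c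
    rw [H.mem_support_iff hf hΛ i ‹_›] at ha hb ⊢
    refine (hf.supports.ordConnected i).out (x := min x z) (y := max y z) ?_ ?_
      ⟨min_le_right _ _, le_max_right _ _⟩
    · rcases hc.1.eq_or_lt with heq | hlt
      · have hzi : z ∈ homeoSupport (f i) := by
          rw [← H.mem_support_iff hf hΛ i hz, ← heq]
          exact hmem i x ha
        rcases min_choice x z with h | h <;> rw [h] <;> assumption
      · obtain ⟨_, _, h1, h2⟩ := (lt_iff_of_fibre H.monotoneOn H.fibre hx hz).1 hlt
        rwa [min_eq_left (h1.trans h2).le]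
    · rcases hc.2.eq_or_lt with heq | hlt
      · have hzi : z ∈ homeoSupport (f i) := by
          rw [← H.mem_support_iff hf hΛ i hz, heq]
          exact hmem i y hb
        rcases max_choice y z with h | h <;> rw [h] <;> assumption
      · obtain ⟨_, _, h1, h2⟩ := (lt_iff_of_fibre H.monotoneOn H.fibre hz hy).1 hlt
        rwa [max_eq_left (h1.trans h2).le]
  · intro i
    obtain ⟨x, hx⟩ := hf.supports.nonempty i
    exact ⟨h x, hmem i x hx⟩
  · intro i k hik
    rw [eq_empty_iff_forall_notMem]
    rintro t ⟨hti, htk⟩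
    obtain ⟨x, hx, rfl⟩ := hsurj t
    rw [H.mem_support_iff hf hΛ _ hx] at hti htk
    exact eq_empty_iff_forall_notMem.1 (hf.supports.disjoint i k hik) x ⟨hti, htk⟩
  · intro i k hik
    obtain ⟨x, hx, hx'⟩ := hf.supports.inter_nonempty i k hik
    exact ⟨h x, hmem i x hx, hmem k x hx'⟩
  · exact fun i k hik => hss i k i (hf.supports.inter_ssubset_left i k hik) inter_subset_left
  · exact fun i k hik => hss i k k (hf.supports.inter_ssubset_right i k hik) inter_subset_right
  · intro i k hik
    obtain ⟨a, ha, hlt⟩ := hf.exists_lt_support hik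
    have hai := hmem i a ha
    -- Monotonicity alone gives only a weak inequality of left ends. It becomes strict because h a
    -- is interior to the i-th image support, yet is a lower bound of the k-th one.
    obtain ⟨ε, hε, hball⟩ := Metric.isOpen_iff.1 (isOpen_homeoSupport _) _ hai
    have hmem' : h a - ε / 2 ∈ homeoSupport (Φ (chainGen f i)) := hball (by
      rw [Metric.mem_ball, Real.dist_eq, abs_lt]
      constructor <;> linarith)
    calc leftEnd (homeoSupport (Φ (chainGen f i))) ≤ ((h a - ε / 2 : ℝ) : EReal) :=
          sInf_le (mem_image_of_mem _ hmem')
      _ < ((h a : ℝ) : EReal) := EReal.coe_lt_coe_iff.2 (by linarith)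
      _ ≤ leftEnd (homeoSupport (Φ (chainGen f k))) := by
        refine le_sInf ?_
        rintro _ ⟨t, ht, rfl⟩
        obtain ⟨y, hy, rfl⟩ := hsurj t
        rw [H.mem_support_iff hf hΛ k hy] at ht
        exact EReal.coe_le_coe_iff.2 (H.monotoneOn (mem_groupSupport_of_mem ha) hy (hlt y ht).le)
  · intro i t
    obtain ⟨x, hx, rfl⟩ := hsurj t
    rw [← H.semiconj _ x hx]
    exact H.monotoneOn hx (apply_mem_groupSupport (generator_mem f i) hx) (hf.le_apply i x)

/-- The images of adjacent generators do not commute, as they form a prechain; since proper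
quotients of F are abelian, Φ is injective on the copy of F they generate. -/
theorem IsStaircaseSemiconj.isChainFamily (H : IsStaircaseSemiconj (chainGroup f) Λ h Φ)
    (hf : IsChainFamily f) (hΛ : IsClosedInvariant (chainGroup f) Λ) :
    IsChainFamily fun i => Φ (chainGen f i) := by
  have hpre := H.isPrechain hf.toIsPrechain hΛ
  refine { hpre with thompson := fun i k hik => ?_ }
  obtain ⟨e⟩ := hf.thompson i k hik
  have hle : Subgroup.closure {f i, f k} ≤ chainGroup f := by
    apply Subgroup.closure_mono
    rintro _ (rfl | rfl)
    · exact mem_range_self i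
    · exact mem_range_self k
  set ψ : Subgroup.closure {f i, f k} →* (ℝ ≃ₜ ℝ) := Φ.comp (Subgroup.inclusion hle)
  have hi : ψ ⟨f i, Subgroup.subset_closure (by simp)⟩ = Φ (chainGen f i) := rfl
  have hk : ψ ⟨f k, Subgroup.subset_closure (by simp)⟩ = Φ (chainGen f k) := rfl
  have hinj : Function.Injective ψ := by
    by_contra hn
    have hn' : ¬ Function.Injective (ψ.comp e.symm.toMonoidHom) := fun hc => hn fun a b hab =>
      e.injective (hc (by
        change ψ (e.symm (e a)) = ψ (e.symm (e b))
        rwa [e.symm_apply_apply, e.symm_apply_apply]))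
    have hc := thompsonF_hom_commute_of_not_injective _ hn'
      (e ⟨f i, Subgroup.subset_closure (by simp)⟩) (e ⟨f k, Subgroup.subset_closure (by simp)⟩)
    change Commute (ψ (e.symm (e _))) (ψ (e.symm (e _))) at hc
    rw [e.symm_apply_apply, e.symm_apply_apply, hi, hk] at hc
    exact hpre.not_commute hik hc
  have hrange : ψ.range = Subgroup.closure {Φ (chainGen f i), Φ (chainGen f k)} := by
    rw [range_eq_closure_image]
    congr 1
    ext g
    constructor
    · rintro ⟨⟨_, _⟩, (rfl | rfl), rfl⟩
      · exact Or.inl rfl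
      · exact Or.inr rfl
    · rintro (rfl | rfl)
      · exact ⟨⟨f i, Subgroup.subset_closure (by simp)⟩, Or.inl rfl, rfl⟩
      · exact ⟨⟨f k, Subgroup.subset_closure (by simp)⟩, Or.inr rfl, rfl⟩
  exact ⟨(MulEquiv.subgroupCongr hrange).symm.trans ((MonoidHom.ofInjective hinj).symm.trans e)⟩

theorem range_eq_chainGroup (Φ : chainGroup f →* (ℝ ≃ₜ ℝ)) :
    Φ.range = chainGroup fun i => Φ (chainGen f i) := by
  refine (range_eq_closure_image Φ).trans (congrArg Subgroup.closure ?_)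
  ext g
  constructor
  · rintro ⟨⟨_, _⟩, ⟨i, rfl⟩, rfl⟩
    exact ⟨i, rfl⟩
  · rintro ⟨i, rfl⟩
    exact ⟨chainGen f i, mem_range_self i, rfl⟩

theorem IsStaircaseSemiconj.groupSupport_eq (H : IsStaircaseSemiconj (chainGroup f) Λ h Φ)
    (hf : IsPrechain f) (hΛ : IsClosedInvariant (chainGroup f) Λ) :
    groupSupport (chainGroup fun i => Φ (chainGen f i)) = univ := by
  rw [eq_univ_iff_forall]
  intro t
  obtain ⟨x, hx, rfl⟩ := eq_univ_iff_forall.1 H.image_eq t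
  obtain ⟨i, hi⟩ := mem_groupSupport_chainGroup.1 hx
  exact mem_groupSupport_chainGroup.2 ⟨i, (H.mem_support_iff hf hΛ i hx).2 hi⟩

theorem IsStaircaseSemiconj.actsMinimally (H : IsStaircaseSemiconj (chainGroup f) Λ h Φ)
    (hacc : ∀ x ∈ groupSupport (chainGroup f), Λ ⊆ closure (groupOrbit (chainGroup f) x))
    (hΛI : Λ ⊆ groupSupport (chainGroup f)) :
    ActsMinimally (chainGroup fun i => Φ (chainGen f i)) := by
  intro t _ s _
  obtain ⟨x, hx, rfl⟩ := eq_univ_iff_forall.1 H.image_eq t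
  obtain ⟨y, hy, rfl⟩ := eq_univ_iff_forall.1 H.image_eq s
  rw [Metric.mem_closure_iff]
  intro ε hε
  obtain ⟨z, hz, hze⟩ := eq_univ_iff_forall.1 H.image_eq (h y + ε / 2)
  -- Some l ∈ Λ has h l within ε / 2 of h y; the orbit of x accumulates at l, and continuity of h
  -- supplies the other ε / 2.
  obtain ⟨l, hl, h1, h2⟩ := (lt_iff_of_fibre H.monotoneOn H.fibre hy hz).1
    (by rw [hze]; linarith)
  have hlI := hΛI hl
  have hcl : h l ∈ Icc (h y) (h z) := ⟨H.monotoneOn hy hlI h1.le, H.monotoneOn hlI hz h2.le⟩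
  have hnhds : groupSupport (chainGroup f) ∈ nhds l :=
    isOpen_groupSupport_chainGroup.mem_nhds hlI
  have hc := (H.continuousOn.continuousAt hnhds).eventually (Metric.ball_mem_nhds (h l) (half_pos hε))
  obtain ⟨_, hball, g, hg, rfl⟩ := mem_closure_iff_nhds.1 (hacc x hx hl) _ hc
  refine ⟨_, ⟨Φ ⟨g, hg⟩, ?_, rfl⟩, ?_⟩
  · rw [← range_eq_chainGroup]
    exact ⟨_, rfl⟩
  · rw [← H.semiconj _ x hx]
    have hb : dist (h (g x)) (h l) < ε / 2 := hball
    have hd : dist (h y) (h l) ≤ ε / 2 := by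
      rw [Real.dist_eq, abs_le]
      constructor <;> linarith [hcl.1, hcl.2]
    calc dist (h y) (h (g x)) ≤ dist (h y) (h l) + dist (h l) (h (g x)) := dist_triangle _ _ _
      _ < ε := by rw [dist_comm (h l)]; linarith

/-! ### Minimal invariant sets -/

theorem apply_mem_groupOrbit {G : Subgroup (ℝ ≃ₜ ℝ)} {g : ℝ ≃ₜ ℝ} (hg : g ∈ G) {x y : ℝ}
    (hy : y ∈ groupOrbit G x) : g y ∈ groupOrbit G x := by
  obtain ⟨k, hk, rfl⟩ := hy
  exact ⟨g * k, mul_mem hg hk, rfl⟩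

theorem self_mem_groupOrbit (G : Subgroup (ℝ ≃ₜ ℝ)) (x : ℝ) : x ∈ groupOrbit G x :=
  ⟨1, one_mem _, rfl⟩

theorem apply_mem_closure_groupOrbit {G : Subgroup (ℝ ≃ₜ ℝ)} {g : ℝ ≃ₜ ℝ} (hg : g ∈ G) {x y : ℝ}
    (hy : y ∈ closure (groupOrbit G x)) : g y ∈ closure (groupOrbit G x) :=
  map_mem_closure g.continuous hy fun _ hz => apply_mem_groupOrbit hg hz

theorem isClosedInvariant_closure_groupOrbit (G : Subgroup (ℝ ≃ₜ ℝ)) {x : ℝ}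
    (hx : x ∈ groupSupport G) :
    IsClosedInvariant G (closure (groupOrbit G x) ∩ groupSupport G) where
  nonempty := ⟨x, subset_closure (self_mem_groupOrbit G x), hx⟩
  subset_support := inter_subset_right
  closed_in_support := fun _ hy =>
    ⟨closure_minimal inter_subset_left isClosed_closure hy.1, hy.2⟩
  invariant := fun _ hg _ hy =>
    ⟨apply_mem_closure_groupOrbit hg hy.1, apply_mem_groupSupport hg hy.2⟩

/-- A point such that compact subsets of the support can be contracted to its right. -/
def IsContractingPoint (G : Subgroup (ℝ ≃ₜ ℝ)) (p : ℝ) : Prop :=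
  p ∈ groupSupport G ∧ ∀ x ∈ groupSupport G, ∀ ε > p, ∃ k ∈ G, p < k x ∧ k x < ε

/-- The contraction moves any point of Λ arbitrarily close to p, so p ∈ Λ, and then so is the
closure of its orbit within the support. -/
theorem IsContractingPoint.subset {G : Subgroup (ℝ ≃ₜ ℝ)} {p : ℝ} (hp : IsContractingPoint G p)
    (hΛ : IsClosedInvariant G Λ) : closure (groupOrbit G p) ∩ groupSupport G ⊆ Λ := by
  have hpΛ : p ∈ Λ := by
    refine hΛ.closed_in_support ⟨?_, hp.1⟩
    obtain ⟨x, hx⟩ := hΛ.nonempty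
    rw [Metric.mem_closure_iff]
    intro ε hε
    obtain ⟨k, hk, h1, h2⟩ := hp.2 x (hΛ.subset_support hx) (p + ε) (by linarith)
    refine ⟨k x, hΛ.invariant k hk x hx, ?_⟩
    rw [Real.dist_eq, abs_lt]
    constructor <;> linarith
  have horb : groupOrbit G p ⊆ Λ := by
    rintro _ ⟨k, hk, rfl⟩
    exact hΛ.invariant k hk p hpΛ
  exact fun y hy => hΛ.closed_in_support ⟨closure_mono horb hy.1, hy.2⟩

/-- Contracting p itself yields orbit points k p ≠ p arbitrarily close to p; homeomorphisms in G
transport this along the orbit. -/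
theorem IsContractingPoint.preperfect {G : Subgroup (ℝ ≃ₜ ℝ)} {p : ℝ}
    (hp : IsContractingPoint G p) : Preperfect (groupOrbit G p) := by
  rintro _ ⟨g, hg, rfl⟩
  rw [accPt_iff_nhds]
  intro U hU
  have hU' : g ⁻¹' U ∈ nhds p := g.continuous.continuousAt hU
  obtain ⟨ε, hε, hball⟩ := Metric.mem_nhds_iff.1 hU'
  obtain ⟨k, hk, h1, h2⟩ := hp.2 p hp.1 (p + ε) (by linarith)
  refine ⟨g (k p), ⟨hball ?_, g * k, mul_mem hg hk, rfl⟩, fun hc => h1.ne' (g.injective hc)⟩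
  rw [Metric.mem_ball, Real.dist_eq, abs_lt]
  constructor <;> linarith

theorem IsContractingPoint.actsMinimally {G : Subgroup (ℝ ≃ₜ ℝ)} {p : ℝ}
    (hp : IsContractingPoint G p) (hsub : groupSupport G ⊆ closure (groupOrbit G p)) :
    ActsMinimally G := fun _ hx _ hy =>
  (hp.subset (isClosedInvariant_closure_groupOrbit G hx) ⟨hsub hy, hy⟩).1

/-- A nontrivial connected subset would give the orbit closure an interior W. It is invariant and
meets the orbit, so p ∈ W. Without minimality, supp G \ W is a nonempty closed invariant set, which
must contain p: a contradiction. -/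
theorem IsContractingPoint.isTotallyDisconnected {G : Subgroup (ℝ ≃ₜ ℝ)} {p : ℝ}
    (hp : IsContractingPoint G p) (hmin : ¬ ActsMinimally G) :
    IsTotallyDisconnected (closure (groupOrbit G p)) := by
  intro t ht hpre
  by_contra hns
  obtain ⟨x, hx, y, hy, hne⟩ := not_subsingleton_iff.1 hns
  obtain ⟨u, v, huv, hsub⟩ : ∃ u v, u < v ∧ Icc u v ⊆ closure (groupOrbit G p) := by
    rcases lt_or_gt_of_ne hne with h | h
    · exact ⟨x, y, h, (hpre.Icc_subset hx hy).trans ht⟩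
    · exact ⟨y, x, h, (hpre.Icc_subset hy hx).trans ht⟩
  set W := interior (closure (groupOrbit G p)) with hW
  have hIoo : Ioo u v ⊆ W := interior_maximal (Ioo_subset_Icc_self.trans hsub) isOpen_Ioo
  obtain ⟨m, hm⟩ := nonempty_Ioo.2 huv
  obtain ⟨w, hw, hwo⟩ := mem_closure_iff.1 (hsub (Ioo_subset_Icc_self hm)) _ isOpen_Ioo hm
  have hinv : ∀ g ∈ G, ∀ z, g z ∈ W → z ∈ W := by
    intro g hg z hz
    refine (interior_maximal (s := closure (groupOrbit G p)) (t := g ⁻¹' W) ?_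
      (isOpen_interior.preimage g.continuous)) hz
    intro z' hz'
    have := apply_mem_closure_groupOrbit (inv_mem hg) (interior_subset hz')
    rwa [homeo_inv_apply_self] at this
  obtain ⟨g, hg, rfl⟩ := hwo
  have hpW : p ∈ W := hinv g hg p (hIoo hw)
  apply hmin
  apply hp.actsMinimally
  by_contra hnot
  obtain ⟨z, hz, hzn⟩ := not_subset.1 hnot
  have hcl : IsClosedInvariant G (groupSupport G \ W) := by
    refine ⟨⟨z, hz, fun hc => hzn (interior_subset hc)⟩, sdiff_subset, ?_, ?_⟩
    · rintro z' ⟨hz', hzI⟩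
      refine ⟨hzI, ?_⟩
      have : closure (groupSupport G \ W) ⊆ Wᶜ :=
        closure_minimal (fun a ha => ha.2) isOpen_interior.isClosed_compl
      exact this hz'
    · exact fun k hk a ha => ⟨apply_mem_groupSupport hk ha.1, fun hc => ha.2 (hinv k hk a hc)⟩
  exact (hp.subset hcl ⟨subset_closure (self_mem_groupOrbit G p), hp.1⟩).2 hpW

theorem IsContractingPoint.isExceptionalMinimal {G : Subgroup (ℝ ≃ₜ ℝ)} {p : ℝ}
    (hp : IsContractingPoint G p) (hopen : IsOpen (groupSupport G)) (hmin : ¬ ActsMinimally G) :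
    IsExceptionalMinimal G (closure (groupOrbit G p) ∩ groupSupport G) where
  toIsClosedInvariant := isClosedInvariant_closure_groupOrbit G hp.1
  minimal := fun _ hsub hΛ' => hsub.antisymm (hp.subset hΛ')
  preperfect := by
    rw [inter_comm]
    exact hp.preperfect.perfect_closure.acc.open_inter hopen
  totallyDisconnected := fun t ht => hp.isTotallyDisconnected hmin t (ht.trans inter_subset_left)

theorem IsContractingPoint.eq_of_isMinimalInvariant {G : Subgroup (ℝ ≃ₜ ℝ)} {p : ℝ}
    (hp : IsContractingPoint G p) (hΛ : IsMinimalInvariant G Λ) :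
    Λ = closure (groupOrbit G p) ∩ groupSupport G :=
  (hΛ.minimal _ (hp.subset hΛ.toIsClosedInvariant)
    (isClosedInvariant_closure_groupOrbit G hp.1)).symm

theorem not_isTotallyDisconnected_of_isOpen_subset {U s : Set ℝ} (hU : IsOpen U)
    (hne : U.Nonempty) (hUs : U ⊆ s) : ¬ IsTotallyDisconnected s := by
  intro hs
  obtain ⟨x, hx⟩ := hne
  obtain ⟨ε, hε, hball⟩ := Metric.isOpen_iff.1 hU x hx
  have h1 : x + ε / 2 ∈ Metric.ball x ε := by
    rw [Metric.mem_ball, Real.dist_eq, abs_lt]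
    constructor <;> linarith
  have := hs _ (hball.trans hUs) (convex_ball x ε).isPreconnected (Metric.mem_ball_self hε) h1
  linarith

end Chain

/-! ### The main theorem -/

theorem mainTheorem2 (n : ℕ) (hn : 2 ≤ n) (f : Fin n → (ℝ ≃ₜ ℝ)) (hf : IsChainFamily f) :
    -- exactly one of the two alternatives holds, the second one in either of its two forms
    Xor (ActsMinimally (chainGroup f))
      (∃ x : ℝ, Perfect (closure (groupOrbit (chainGroup f) x)) ∧
        IsTotallyDisconnected (closure (groupOrbit (chainGroup f) x))) ∧
    Xor (ActsMinimally (chainGroup f)) (∃! Λ : Set ℝ, IsExceptionalMinimal (chainGroup f) Λ) ∧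
    -- the minimal case
    (ActsMinimally (chainGroup f) →
      (∀ (N : Subgroup (chainGroup f)) [N.Normal], N ≠ ⊥ →
        ∀ a b : chainGroup f ⧸ N, a * b = b * a) ∧
      IsSimpleGroup (commutator (chainGroup f))) ∧
    -- the exceptional case: the canonical quotient exists, and is unique up to conjugacy
    (∀ Λ : Set ℝ, IsExceptionalMinimal (chainGroup f) Λ →
      (∃ (h : ℝ → ℝ) (Φ : chainGroup f →* (ℝ ≃ₜ ℝ)) (f' : Fin n → (ℝ ≃ₜ ℝ)),
        IsStaircaseSemiconj (chainGroup f) Λ h Φ ∧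
        (∀ i, Φ (chainGen f i) = f' i) ∧
        IsChainFamily f' ∧
        Φ.range = chainGroup f' ∧
        groupSupport (chainGroup f') = Set.univ ∧
        ActsMinimally (chainGroup f')) ∧
      (∀ (h₁ h₂ : ℝ → ℝ) (Φ₁ Φ₂ : chainGroup f →* (ℝ ≃ₜ ℝ)),
        IsStaircaseSemiconj (chainGroup f) Λ h₁ Φ₁ →
        IsStaircaseSemiconj (chainGroup f) Λ h₂ Φ₂ →
        ∃ k ∈ HomeoPlus, (∀ x ∈ groupSupport (chainGroup f), h₂ x = k (h₁ x)) ∧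
          ∀ g, Φ₂ g = k * Φ₁ g * k⁻¹)) := by
  obtain ⟨p, hpI, hcon⟩ := hf.toIsPrechain.exists_contracting_point hn
  have hp : IsContractingPoint (chainGroup f) p :=
    ⟨hpI, fun x hx ε hε => hcon x hx x hx le_rfl ε hε⟩
  have hopen := isOpen_groupSupport_chainGroup (f := f)
  have hne : (groupSupport (chainGroup f)).Nonempty := ⟨p, hpI⟩
  refine ⟨?_, ?_, fun hmin => ⟨fun N _ hN a b => hf.quotient_commute hn hmin N hN a b,
    hf.isSimpleGroup_commutator hn hmin⟩, fun Λ hΛ => ⟨?_, fun _ _ _ _ H₁ H₂ => H₁.exists_conj H₂⟩⟩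
  · by_cases hmin : ActsMinimally (chainGroup f)
    · refine Or.inl ⟨hmin, ?_⟩
      rintro ⟨x, hperf, htd⟩
      by_cases hx : x ∈ groupSupport (chainGroup f)
      · exact not_isTotallyDisconnected_of_isOpen_subset hopen hne (hmin x hx) htd
      -- The alternative quantifies over all real x; outside the support the orbit is a single
      -- point, which is isolated and so not perfect.
      · have horb : groupOrbit (chainGroup f) x = {x} := by
          ext y
          constructor
          · rintro ⟨g, hg, rfl⟩
            by_contra hgx
            exact hx (mem_groupSupport.2 ⟨g, hg, hgx⟩)
          · rintro rfl
            exact self_mem_groupOrbit _ _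
        rw [horb, closure_singleton] at hperf
        obtain ⟨y, hy, hyx⟩ := accPt_iff_nhds.1 (hperf.acc x rfl) univ Filter.univ_mem
        exact hyx hy.2
    · exact Or.inr ⟨⟨p, hp.preperfect.perfect_closure, hp.isTotallyDisconnected hmin⟩, hmin⟩
  · by_cases hmin : ActsMinimally (chainGroup f)
    · refine Or.inl ⟨hmin, ?_⟩
      rintro ⟨Λ, hΛ, -⟩
      refine not_isTotallyDisconnected_of_isOpen_subset hopen hne ?_ hΛ.totallyDisconnected
      rw [hp.eq_of_isMinimalInvariant hΛ.toIsMinimalInvariant]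
      exact subset_inter (hmin p hpI) Subset.rfl
    · exact Or.inr ⟨⟨_, hp.isExceptionalMinimal hopen hmin,
        fun Λ hΛ => hp.eq_of_isMinimalInvariant hΛ.toIsMinimalInvariant⟩, hmin⟩
  · have hcl := hΛ.toIsClosedInvariant
    obtain ⟨l, hl⟩ := hcl.nonempty
    have hlI := hcl.subset_support hl
    obtain ⟨h, hcont, hmono, himg, hfib⟩ := exists_staircase
      hf.toIsPrechain.ordConnected_support hne hcl.subset_support hΛ.preperfect
      (fun x hx => by
        obtain ⟨g, hg, hlt⟩ := hf.toIsPrechain.exists_lt_apply hlI hx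
        exact ⟨g l, hcl.invariant g hg l hl, hlt⟩)
      (fun x hx => by
        obtain ⟨g, hg, hlt⟩ := hf.toIsPrechain.exists_apply_lt hx hlI
        exact ⟨g l, hcl.invariant g hg l hl, hlt⟩)
    obtain ⟨Φ, H⟩ := exists_staircaseSemiconj hf.toIsPrechain.chainGroup_le hcl.invariant hcont
      hmono himg hfib
    refine ⟨h, Φ, fun i => Φ (chainGen f i), H, fun _ => rfl, H.isChainFamily hf hcl,
      range_eq_chainGroup Φ, H.groupSupport_eq hf.toIsPrechain hcl,
      H.actsMinimally (fun x hx => ?_) hcl.subset_support⟩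
    -- Λ is the closed orbit of p in the support, and this lies in every orbit closure.
    rw [hp.eq_of_isMinimalInvariant hΛ.toIsMinimalInvariant]
    exact (hp.subset (isClosedInvariant_closure_groupOrbit _ hx)).trans inter_subset_left
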